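/- Let $E$ be an elliptic curve over $\mathbb Q$ defined by a Weierstrass equation $y^2+a_1xy+a_3y=x^3+a_2x^2+a_4x+a_6$ with integer coefficients (not assumed minimal). For $P\in E(\mathbb Q)$ and $n\in\mathbb N$ write $x(nP)=A_n(E,P)/B_n(E,P)^2$ with $A_n(E,P),B_n(E,P)$ coprime integers and $B_n(E,P)\ge 0$, and put $B_n(E,P)=0$ if $nP=O$. For $P\neq O$ define $$\beta_n(E,P)=\operatorname{sign}\bigl(\psi_n(x(P),y(P))\bigr)\cdot\frac{B_n(E,P)}{B_1(E,P)},$$ where $\psi_n$ is the $n$-th division polynomial of $E$ ($\psi_0=0$, $\psi_1=1$, $\psi_2=2y+a_1x+a_3$, and so on). For a prime $p$, the point $P$ is called non-singular modulo $p$ if its reduction modulo $p$ is a non-singular point of the projective cubic over $\mathbb F_p$ obtained by reducing the given equation modulo $p$. Let $r(p,P)$ be the order of $P$ modulo the subgroup of points that are non-singular modulo $p$, i.e. the least $n\ge 1$ such that $nP$ is non-singular modulo $p$, and let $M(P)=\operatorname{lcm}_p\, r(p,P)$, the least common multiple over all primes $p$. A sequence of integers $(h_n)_{n\in\mathbb N}$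 is called an elliptic divisibility sequence in Ward's sense if $h_0=0$, $h_1=1$, $h_2\mid h_4$, and $$h_{m+n}h_{m-n}h_r^2=h_{m+r}h_{m-r}h_n^2-h_{n+r}h_{n-r}h_m^2\qquad\text{for all integers } m\ge n\ge r\ge 0.$$ Then: 1. If $P\in E(\mathbb Q)$ is a non-torsion point that is non-singular modulo every prime, then $(\beta_n(E,P))_{n\in\mathbb N}$ is a sequence of integers and an elliptic divisibility sequence in Ward's sense. 2. For every non-torsion point $P\in E(\mathbb Q)$, the number $M(P)$ is a well-defined positive integer, and for the multiple $Q=M(P)P$ of $P$ the sequence $(\beta_n(E,Q))_{n\in\mathbb N}$ is an elliptic divisibility sequence in Ward's sense. -/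

import Mathlib

namespace EDS

open Polynomial

/-- A sequence of integers `h 0, h 1, …` is an elliptic divisibility sequence in the sense of Ward. -/
structure IsWardEDS (h : ℕ → ℤ) : Prop where
  zero : h 0 = 0
  one : h 1 = 1
  two_dvd_four : h 2 ∣ h 4
  rel : ∀ m n r : ℕ, r ≤ n → n ≤ m →
    h (m + n) * h (m - n) * h r ^ 2 =
      h (m + r) * h (m - r) * h n ^ 2 - h (n + r) * h (n - r) * h m ^ 2

/-- A sequence of rational numbers is a Ward elliptic divisibility sequence if all of its terms are
integers, and these integers form a Ward elliptic divisibility sequence. -/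
def IsRatWardEDS (b : ℕ → ℚ) : Prop :=
  ∃ h : ℕ → ℤ, (∀ n, (h n : ℚ) = b n) ∧ IsWardEDS h

/-- The group `E(ℚ)`, where `E` is given by a Weierstrass equation `W` with integer coefficients. -/
abbrev RatPoint (W : WeierstrassCurve ℤ) : Type := (W.baseChange ℚ).toAffine.Point

section Sequences

variable {W : WeierstrassCurve ℤ}

/-- `B(P) ≥ 0` is such that `x(P) = A / B(P) ^ 2` in lowest terms, and `B(O) = 0`.
That the denominator of `x(P)` is a perfect square is `denomRoot_sq` below. -/
def denomRoot : RatPoint W → ℕ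
  | .zero => 0
  | .some x _ _ => Nat.sqrt x.den

/-- The value `ψₙ(x(P), y(P))` of the `n`-th division polynomial at an affine point `P`
(the value at `O` is not meaningful, and is set to be `0`). -/
noncomputable def divPolyValue (n : ℕ) : RatPoint W → ℚ
  | .zero => 0
  | .some x y _ => ((W.baseChange ℚ).ψ (n : ℤ)).evalEval x y

/-- `βₙ(E, P) = sign(ψₙ(x(P), y(P))) * Bₙ(E, P) / B₁(E, P)` with `Bₙ(E, P) = B(nP)`. -/
noncomputable def beta (P : RatPoint W) (n : ℕ) : ℚ :=
  (SignType.sign (divPolyValue n P) : ℚ) * ((denomRoot (n • P) : ℚ) / (denomRoot (1 • P) : ℚ))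

/-- Homogeneous coordinates in the projective plane over `ℚ` of a point of `E(ℚ)`. -/
def homCoords : RatPoint W → Fin 3 → ℚ
  | .zero => ![0, 1, 0]
  | .some x y _ => ![x, y, 1]

/-- `v` is a triple of coprime integers which are homogeneous coordinates of `P`.
Such a triple exists and is unique up to sign. -/
def IsPrimitiveCoords (P : RatPoint W) (v : Fin 3 → ℤ) : Prop :=
  (∀ d : ℤ, (∀ i, d ∣ v i) → IsUnit d) ∧
    ∃ c : ℚ, c ≠ 0 ∧ ∀ i, (v i : ℚ) = c * homCoords P i

/-- `P` is non-singular modulo `p`: the reduction of `P` modulo `p` is a non-singular point of the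
projective plane cubic over `ZMod p` obtained by reducing the coefficients of `W` modulo `p`. -/
def IsNonsingularMod (p : ℕ) (P : RatPoint W) : Prop :=
  ∃ v : Fin 3 → ℤ, IsPrimitiveCoords P v ∧
    (W.map (Int.castRingHom (ZMod p))).toProjective.Nonsingular (fun i => (v i : ZMod p))

/-- The order `r(p, P)` of the class of `P` modulo the subgroup `E₀` of the points that are
non-singular modulo `p`: the least `n > 0` with `nP ∈ E₀` (and `0` if there were no such `n`). -/
noncomputable def redOrder (p : ℕ) (P : RatPoint W) : ℕ :=
  sInf {n : ℕ | 0 < n ∧ IsNonsingularMod p (n • P)}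

/-- `M(P)`, the least common multiple of the numbers `r(p, P)` over all primes `p`: the least
`m > 0` that is a multiple of all of them (and `0` if there were no such `m`). -/
noncomputable def lcmRedOrder (P : RatPoint W) : ℕ :=
  sInf {m : ℕ | 0 < m ∧ ∀ p : ℕ, p.Prime → redOrder p P ∣ m}

end Sequences

/-- The denominator of the abscissa of an affine rational point is the square of `denomRoot`. -/
theorem denomRoot_sq {W : WeierstrassCurve ℤ} (x y : ℚ)
    (h : (W.baseChange ℚ).toAffine.Nonsingular x y) :
    denomRoot (W := W) (.some x y h) ^ 2 = x.den := by
  suffices H : ∃ k : ℕ, x.den = k * k by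
    obtain ⟨k, hk⟩ := H
    simp only [denomRoot, hk, Nat.sqrt_eq, sq]
  have he := (WeierstrassCurve.Affine.equation_iff x y).1 h.1
  simp only [WeierstrassCurve.baseChange, WeierstrassCurve.map, algebraMap_int_eq,
    eq_intCast, WeierstrassCurve.toAffine] at he
  set d : ℤ := (x.den : ℤ) with hd
  have hd0 : d ≠ 0 := by simp [hd]
  have hdq : (d : ℚ) ≠ 0 := by exact_mod_cast hd0
  have hx : x * d = x.num := by simp [hd, Rat.mul_den_eq_num]
  have hcop : IsCoprime x.num d := by
    rw [Int.isCoprime_iff_gcd_eq_one]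
    exact x.reduced
  set a : ℤ := x.num with ha
  set m : ℤ := W.a₁ * a + W.a₃ * d with hm
  set c : ℤ := a ^ 3 + W.a₂ * a ^ 2 * d + W.a₄ * a * d ^ 2 + W.a₆ * d ^ 3 with hc
  have hY : (d ^ 2 * y) ^ 2 + d * m * (d ^ 2 * y) = d * c := by
    have hxa : (a : ℚ) = x * d := hx.symm
    rw [hm, hc]
    push_cast
    rw [hxa]
    linear_combination (d : ℚ) ^ 4 * he
  -- the number `d ^ 2 * y` is an integer
  obtain ⟨Y, hYy⟩ : ∃ Y : ℤ, (Y : ℚ) = d ^ 2 * y := by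
    have hint : IsIntegral ℤ ((d : ℚ) ^ 2 * y) := by
      refine ⟨X ^ 2 + (C (d * m) * X - C (d * c)), ?_, ?_⟩
      · apply Polynomial.monic_X_pow_add
        compute_degree!
      · simp only [eval₂_add, eval₂_sub, eval₂_mul, eval₂_X_pow, eval₂_X, eval₂_C,
          algebraMap_int_eq, Int.coe_castRingHom]
        push_cast
        linear_combination hY
    obtain ⟨Y, hY'⟩ := IsIntegrallyClosed.isIntegral_iff.1 hint
    exact ⟨Y, (eq_intCast (algebraMap ℤ ℚ) Y).symm.trans hY'⟩
  rw [← hYy] at hY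
  have hZ : Y ^ 2 + d * m * Y = d * c := by exact_mod_cast hY
  have hcd : IsCoprime c d := by
    have h3 : IsCoprime (a ^ 3 + d * (W.a₂ * a ^ 2 + W.a₄ * a * d + W.a₆ * d ^ 2)) d :=
      (hcop.pow_left (m := 3)).add_mul_left_left _
    convert h3 using 1
    rw [hc]; ring
  have hgpos : 0 < Int.gcd Y d := Int.gcd_pos_of_ne_zero_right _ hd0
  obtain ⟨Y', d', hcop', hY', hd'⟩ := Int.exists_gcd_one hgpos
  set g : ℤ := (Int.gcd Y d : ℤ) with hg
  have hg0 : g ≠ 0 := by rw [hg]; exact_mod_cast hgpos.ne'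
  have hco : IsCoprime d' Y' := (Int.isCoprime_iff_gcd_eq_one.2 hcop').symm
  have key : g * (Y' * (Y' + d' * m)) = d' * c := by
    apply mul_left_cancel₀ hg0
    rw [hY', hd'] at hZ
    linear_combination hZ
  have h1 : d' ∣ g := by
    have hco2 : IsCoprime d' (Y' * (Y' + d' * m)) :=
      hco.mul_right (by simpa [mul_comm] using hco.add_mul_left_right m)
    exact hco2.dvd_of_dvd_mul_right (key ▸ dvd_mul_right _ _)
  have h2 : g ∣ d' := by
    have hgc : IsCoprime g c := by
      refine (hcd.symm).of_isCoprime_of_dvd_left ?_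
      rw [hg]
      exact Int.gcd_dvd_right _ _
    exact hgc.dvd_of_dvd_mul_right (key ▸ dvd_mul_right _ _)
  have habs : d'.natAbs = g.natAbs := Nat.dvd_antisymm (Int.natAbs_dvd_natAbs.2 h1)
    (Int.natAbs_dvd_natAbs.2 h2)
  refine ⟨g.natAbs, ?_⟩
  have : d.natAbs = d'.natAbs * g.natAbs := by rw [← Int.natAbs_mul, ← hd']
  rw [habs] at this
  simpa [hd] using this

end EDS

/-! For a point P = (A/B², C/B³) of infinite order, the values ψ_n of the division polynomials
satisfy ψ_{m+n} ψ_{m-n} = (x(nP) - x(mP)) ψ_m² ψ_n², from which Ward's relation is immediate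
(`IsNet.rel`, `isNet_ψ`). The weights balance, so the integers H_n = B^(n²-1) ψ_n obey the same
relation, and x(nP) = (A H_n² - H_{n+1} H_{n-1}) / (B H_n)² (`exists_intModel`).

The first claim thus reduces to this fraction being in lowest terms, for then B_n = |B H_n| and β_n
= H_n. A prime dividing B does not divide the numerator, which is A^(n²) modulo B². A prime dividing
H_n and the numerator divides two consecutive terms of H. This forces it to divide H_2 and H_3
(`eq_zero_of_consecutive_zeros`), which happens exactly when P is singular modulo that prime
(`IsIntModel.isSmoothAt_iff`).

For the second claim, M(P)P must be non-singular modulo every prime. Non-singularity passes to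
multiples (`IsSmoothAt.nsmul`). Each r(p, P) is finite by the pigeonhole principle modulo a power of
p not dividing Δ (`exists_isNonsingularMod_nsmul`), and it is 1 when p does not divide Δ. -/

namespace EDS

open Polynomial WeierstrassCurve

/-! ### Addition and duplication formulas for abscissas. -/

section PointFormulas

variable {F : Type*} [Field F] {W : WeierstrassCurve.Affine F}

/-- The abscissa of a point, with the value `0` at the point at infinity. -/
def xCoord : W.Point → F
  | .zero => 0
  | .some x _ _ => x

/-- The symmetric biquadratic form that vanishes at the abscissas of three points with sum `0`. -/
def biquad (W : WeierstrassCurve F) (u v w : F) : F :=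
  u ^ 2 * v ^ 2 + u ^ 2 * w ^ 2 + v ^ 2 * w ^ 2 - 2 * u * v * w * (u + v + w) - W.b₂ * (u * v * w)
    - W.b₄ * (u * v + u * w + v * w) - W.b₆ * (u + v + w) - W.b₈

/-- `(2y + a₁x + a₃) ^ 2` as a polynomial in `x`. -/
def twoDivSq (W : WeierstrassCurve F) (u : F) : F :=
  4 * u ^ 3 + W.b₂ * u ^ 2 + 2 * W.b₄ * u + W.b₆

theorem twoDivSq_eq {x y : F} (h : W.Equation x y) :
    twoDivSq W x = (2 * y + W.a₁ * x + W.a₃) ^ 2 := by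
  have e := (Affine.equation_iff x y).1 h
  simp only [twoDivSq, WeierstrassCurve.b₂, WeierstrassCurve.b₄, WeierstrassCurve.b₆]
  linear_combination (-4) * e

variable [DecidableEq F]

/-- The sum and the product of x(P + Q) and x(P - Q) are rational in x(P) and x(Q). The free
parameter w encodes both at once, and the symmetry of `biquad` lets the three abscissas exchange
roles. -/
theorem xCoord_add_sub_mul (P Q : W.Point) (hP : P ≠ 0) (hQ : Q ≠ 0)
    (h : xCoord P ≠ xCoord Q) (w : F) :
    (xCoord (P + Q) - w) * (xCoord (P - Q) - w) * (xCoord P - xCoord Q) ^ 2 =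
      biquad W (xCoord P) (xCoord Q) w := by
  rcases P with _ | ⟨x₁, y₁, h₁⟩
  · exact absurd rfl hP
  rcases Q with _ | ⟨x₂, y₂, h₂⟩
  · exact absurd rfl hQ
  change x₁ ≠ x₂ at h
  have e₁ := (Affine.equation_iff x₁ y₁).1 h₁.1
  have e₂ := (Affine.equation_iff x₂ y₂).1 h₂.1
  have hd : x₁ - x₂ ≠ 0 := sub_ne_zero.2 h
  rw [sub_eq_add_neg (Affine.Point.some x₁ y₁ h₁), Affine.Point.neg_some, Affine.Point.add_of_X_ne h,
    Affine.Point.add_of_X_ne h]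
  simp only [xCoord, Affine.slope_of_X_ne h, Affine.addX, Affine.negY, biquad,
    WeierstrassCurve.b₂, WeierstrassCurve.b₄, WeierstrassCurve.b₆, WeierstrassCurve.b₈]
  field_simp
  linear_combination
    (W.a₁ * W.a₃ * x₁ - W.a₁ * W.a₃ * x₂ + W.a₁ * x₁ * y₁ - 2 * W.a₁ * x₂ * y₂ + W.a₁ ^ 2 * x₁ *
      x₂ - W.a₁ ^ 2 * x₂ ^ 2 + 4 * W.a₂ * x₁ * x₂ - W.a₂ * x₁ ^ 2 - 2 * W.a₂ * x₂ ^ 2 + W.a₃ *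
      y₁ - 2 * W.a₃ * y₂ + W.a₄ * x₁ + W.a₆ + 4 * w * x₁ * x₂ - 2 * w * x₁ ^ 2 - 2 * w * x₂ ^ 2
      + 2 * x₁ * x₂ ^ 2 + 2 * x₁ ^ 2 * x₂ - x₁ ^ 3 - 2 * x₂ ^ 3 + y₁ ^ 2 - 2 * y₂ ^ 2) * e₁ +
    (-W.a₁ * W.a₃ * x₁ + W.a₁ * W.a₃ * x₂ + W.a₁ * x₂ * y₂ + W.a₁ ^ 2 * x₁ * x₂ - W.a₁ ^ 2 * x₁
      ^ 2 + 4 * W.a₂ * x₁ * x₂ - 4 * W.a₂ * x₁ ^ 2 - W.a₂ * x₂ ^ 2 + W.a₃ * y₂ - 2 * W.a₄ * x₁ +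
      W.a₄ * x₂ - W.a₆ + 4 * w * x₁ * x₂ - 2 * w * x₁ ^ 2 - 2 * w * x₂ ^ 2 + 2 * x₁ * x₂ ^ 2 + 2
      * x₁ ^ 2 * x₂ - 4 * x₁ ^ 3 - x₂ ^ 3 + y₂ ^ 2) * e₂

theorem twoDivSq_ne_zero (P : W.Point) (hP : P ≠ 0) (h : P + P ≠ 0) :
    twoDivSq W (xCoord P) ≠ 0 := by
  rcases P with _ | ⟨x, y, hxy⟩
  · exact absurd rfl hP
  simp only [xCoord, twoDivSq_eq hxy.1]
  refine pow_ne_zero 2 fun h0 => h (Affine.Point.add_self_of_Y_eq ?_)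
  rw [Affine.negY]
  linear_combination h0

theorem xCoord_two_nsmul (P : W.Point) (hP : P ≠ 0) (h : P + P ≠ 0) (w : F) :
    (xCoord (P + P) - w) * twoDivSq W (xCoord P) = biquad W (xCoord P) (xCoord P) w := by
  rcases P with _ | ⟨x₁, y₁, h₁⟩
  · exact absurd rfl hP
  have e₁ := (Affine.equation_iff x₁ y₁).1 h₁.1
  have hy : y₁ ≠ W.negY x₁ y₁ := fun hy => h (Affine.Point.add_self_of_Y_eq hy)
  have hd : 2 * y₁ + W.a₁ * x₁ + W.a₃ ≠ 0 := fun h0 => hy (by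
    rw [Affine.negY]; linear_combination h0)
  have hd' : y₁ - W.negY x₁ y₁ = 2 * y₁ + W.a₁ * x₁ + W.a₃ := by rw [Affine.negY]; ring
  rw [Affine.Point.add_self_of_Y_ne hy]
  simp only [xCoord, Affine.slope_of_Y_ne rfl hy, hd', twoDivSq_eq h₁.1]
  simp only [Affine.addX, biquad,
    WeierstrassCurve.b₂, WeierstrassCurve.b₄, WeierstrassCurve.b₆, WeierstrassCurve.b₈]
  generalize he : 2 * y₁ + W.a₁ * x₁ + W.a₃ = e at hd
  field_simp
  subst he
  linear_combination (-W.a₁ ^ 2 - 4 * W.a₂ - 4 * w - 8 * x₁) * e₁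

end PointFormulas

/-! ### Elliptic sequences attached to a sequence of abscissas. -/

section Nets

variable {F : Type*} [Field F]

/-- A sequence that behaves like the abscissas of the multiples of a point of infinite order. -/
structure IsAbscissaSeq (W : WeierstrassCurve F) (X : ℕ → F) : Prop where
  ne : ∀ m n : ℕ, 1 ≤ n → n < m → X n ≠ X m
  add_sub : ∀ (m n : ℕ) (w : F), 1 ≤ n → n < m →
    (X (m + n) - w) * (X (m - n) - w) * (X m - X n) ^ 2 = biquad W (X m) (X n) w
  twoDivSq_ne : twoDivSq W (X 1) ≠ 0
  two : ∀ w : F, (X 2 - w) * twoDivSq W (X 1) = biquad W (X 1) (X 1) w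

/-- The elliptic sequence `h` has the differences of `X` as its cross ratios. -/
structure IsNet (X h : ℕ → F) : Prop where
  zero : h 0 = 0
  one : h 1 = 1
  ne_zero : ∀ n : ℕ, 1 ≤ n → h n ≠ 0
  mul : ∀ m n : ℕ, 1 ≤ n → n ≤ m → h (m + n) * h (m - n) = (X n - X m) * h m ^ 2 * h n ^ 2

variable {W : WeierstrassCurve F} {X h : ℕ → F}

theorem IsNet.rel (H : IsNet X h) {m n r : ℕ} (hr : r ≤ n) (hn : n ≤ m) :
    h (m + n) * h (m - n) * h r ^ 2 =
      h (m + r) * h (m - r) * h n ^ 2 - h (n + r) * h (n - r) * h m ^ 2 := by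
  rcases Nat.eq_zero_or_pos r with rfl | h0
  · simp only [H.zero, add_zero, Nat.sub_zero]
    ring
  · rw [H.mul m n (h0.trans_le hr) hn, H.mul m r h0 (hr.trans hn), H.mul n r h0 hr]
    ring

/-- Induction on the smaller index k. The product of the instances (m + 1, k) and (m - 1, k),
divided by the instance (m, k - 1), is the instance (m, k + 1). The differences of abscissas match
because `biquad` is symmetric: its value at X m, X 1, X k can be read from mP ± P or from kP ± P. -/
theorem isNet_of_step (HX : IsAbscissaSeq W X) (h0 : h 0 = 0) (h1 : h 1 = 1)
    (h2 : h 2 ^ 2 = twoDivSq W (X 1)) (hne : ∀ n : ℕ, 1 ≤ n → h n ≠ 0)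
    (step : ∀ n : ℕ, 2 ≤ n → h (n + 1) * h (n - 1) = (X 1 - X n) * h n ^ 2) : IsNet X h := by
  have main : ∀ n : ℕ, ∀ m : ℕ, n + 1 < m →
      h (m + (n + 1)) * h (m - (n + 1)) = (X (n + 1) - X m) * h m ^ 2 * h (n + 1) ^ 2 := by
    intro n
    induction n using Nat.strong_induction_on with
    | _ n ih =>
      intro m hm
      rcases n with _ | n
      · rw [step m hm, zero_add, h1]
        ring
      have hs := step m (by omega)
      have A := HX.add_sub m 1 (X (n + 1)) le_rfl (by omega)
      have key : (X (n + 1) - X (m + 1)) * (X (n + 1) - X (m - 1)) * (h (m + 1) * h (m - 1)) ^ 2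
          = biquad W (X m) (X 1) (X (n + 1)) * h m ^ 4 := by
        rw [hs, ← A]
        ring
      have B1 := ih n (by omega) (m + 1) (by omega)
      have B2 := ih n (by omega) (m - 1) (by omega)
      rw [show m + 1 + (n + 1) = m + (n + 2) by omega, show m + 1 - (n + 1) = m - n by omega] at B1
      rw [show m - 1 + (n + 1) = m + n by omega, show m - 1 - (n + 1) = m - (n + 2) by omega] at B2
      -- For k = 1 the instance (m, 0) is not available: `h m ^ 2` is cancelled instead, and
      -- duplication replaces addition.
      rcases n with _ | n
      · simp only [zero_add, h1, add_zero, Nat.sub_zero, one_pow, mul_one, one_add_one_eq_two]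
          at B1 B2 key ⊢
        have C := HX.two (X m)
        rw [← h2] at C
        have hm0 : h m ^ 2 ≠ 0 := pow_ne_zero 2 (hne m (by omega))
        have sym : biquad W (X m) (X 1) (X 1) = biquad W (X 1) (X 1) (X m) := by
          simp only [biquad]; ring
        apply mul_left_cancel₀ hm0
        calc h m ^ 2 * (h (m + 2) * h (m - 2)) = (h (m + 2) * h m) * (h m * h (m - 2)) := by ring
          _ = (X 1 - X (m + 1)) * (X 1 - X (m - 1)) * (h (m + 1) * h (m - 1)) ^ 2 := by
            rw [B1, B2]; ring
          _ = _ := by rw [key, sym, ← C]; ring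
      · have C := HX.add_sub (n + 2) 1 (X m) le_rfl (by omega)
        have hs' := step (n + 2) (by omega)
        have B3 := ih n (by omega) m (by omega)
        have hX : X (n + 1) - X m ≠ 0 := sub_ne_zero.2 (HX.ne m (n + 1) (by omega) (by omega))
        have e1 : h (m + (n + 1)) * h (m - (n + 1)) ≠ 0 :=
          mul_ne_zero (hne _ (by omega)) (hne _ (by omega))
        have sym : biquad W (X m) (X 1) (X (n + 1 + 1)) = biquad W (X (n + 2)) (X 1) (X m) := by
          simp only [biquad]; ring
        rw [show n + 2 - 1 = n + 1 by omega] at hs' C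
        simp only [show n + 1 + 1 = n + 2 by omega, show n + 1 + 2 = n + 3 by omega] at *
        apply mul_left_cancel₀ e1
        calc h (m + (n + 1)) * h (m - (n + 1)) * (h (m + (n + 3)) * h (m - (n + 3)))
            = (h (m + (n + 3)) * h (m - (n + 1))) * (h (m + (n + 1)) * h (m - (n + 3))) := by ring
          _ = (X (n + 2) - X (m + 1)) * (X (n + 2) - X (m - 1)) * (h (m + 1) * h (m - 1)) ^ 2
              * h (n + 2) ^ 4 := by rw [B1, B2]; ring
          _ = (X (n + 3) - X m) * (X (n + 1) - X m) * h m ^ 4 *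
              ((X 1 - X (n + 2)) * h (n + 2) ^ 2) ^ 2 := by rw [key, sym, ← C]; ring
          _ = _ := by rw [B3, ← hs']; ring
  refine ⟨h0, h1, hne, fun m n hn hnm => ?_⟩
  rcases hnm.eq_or_lt with rfl | hlt
  · simp [h0]
  · obtain ⟨k, rfl⟩ := Nat.exists_eq_add_of_le' hn
    exact main k m hlt

/-- The sequence with `h 2 = b` and `h (n + 1) * h (n - 1) = (X 1 - X n) * h n ^ 2`. -/
def stepSeq (X : ℕ → F) (b : F) : ℕ → F
  | 0 => 0
  | 1 => 1
  | 2 => b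
  | n + 3 => (X 1 - X (n + 2)) * stepSeq X b (n + 2) ^ 2 / stepSeq X b (n + 1)

theorem stepSeq_ne_zero (HX : IsAbscissaSeq W X) {b : F} (hb : b ≠ 0) :
    ∀ n : ℕ, 1 ≤ n → stepSeq X b n ≠ 0
  | 0, h => absurd h (by omega)
  | 1, _ => by simp [stepSeq]
  | 2, _ => by simpa [stepSeq] using hb
  | n + 3, _ => by
    rw [stepSeq]
    exact div_ne_zero (mul_ne_zero (sub_ne_zero.2 (HX.ne _ _ le_rfl (by omega)))
      (pow_ne_zero 2 (stepSeq_ne_zero HX hb _ (by omega)))) (stepSeq_ne_zero HX hb _ (by omega))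

theorem isNet_stepSeq (HX : IsAbscissaSeq W X) {b : F} (hb : b ^ 2 = twoDivSq W (X 1)) :
    IsNet X (stepSeq X b) := by
  have hb0 : b ≠ 0 := by
    rintro rfl
    exact HX.twoDivSq_ne (by rw [← hb]; ring)
  have hne := stepSeq_ne_zero HX hb0
  refine isNet_of_step HX rfl rfl hb hne fun n hn => ?_
  obtain ⟨k, rfl⟩ := Nat.exists_eq_add_of_le' hn
  change stepSeq X b (k + 3) * stepSeq X b (k + 1) = _
  rw [stepSeq, div_mul_cancel₀ _ (hne _ (by omega))]

/-- The instances (k + 1, k - 1) and (k + 1, k) of the net identity are the even and odd recursions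
that determine `normEDS` from its initial values. -/
theorem IsNet.normEDS_eq (H : IsNet X h) {b c d : F} (h2 : h 2 = b) (h3 : h 3 = c)
    (h4 : h 4 = d * b) (n : ℕ) : normEDS b c d n = h n := by
  have hb : b ≠ 0 := h2 ▸ H.ne_zero 2 (by omega)
  induction n using normEDSRec with
  | zero => simp [H.zero]
  | one => simp [H.one]
  | two => simp [h2]
  | three => simp [h3]
  | four => simp [h4]
  | even m e1 e2 e3 e4 e5 =>
    have e := normEDS_even b c d ((m + 3 : ℕ) : ℤ)
    rw [show ((m + 3 : ℕ) : ℤ) - 1 = ((m + 2 : ℕ) : ℤ) by push_cast; ring,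
      show ((m + 3 : ℕ) : ℤ) + 2 = ((m + 5 : ℕ) : ℤ) by push_cast; ring,
      show ((m + 3 : ℕ) : ℤ) - 2 = ((m + 1 : ℕ) : ℤ) by push_cast; ring,
      show ((m + 3 : ℕ) : ℤ) + 1 = ((m + 4 : ℕ) : ℤ) by push_cast; ring,
      e1, e2, e3, e4, e5] at e
    apply mul_right_cancel₀ hb
    rw [show ((2 * (m + 3) : ℕ) : ℤ) = 2 * ((m + 3 : ℕ) : ℤ) by push_cast; ring, e]
    have f := H.mul (m + 4) (m + 2) (by omega) (by omega)
    have f1 := H.mul (m + 4) 1 le_rfl (by omega)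
    have f2 := H.mul (m + 2) 1 le_rfl (by omega)
    rw [show m + 4 + (m + 2) = 2 * (m + 3) by omega, show m + 4 - (m + 2) = 2 by omega, h2] at f
    rw [show m + 4 + 1 = m + 5 by omega, show m + 4 - 1 = m + 3 by omega, H.one] at f1
    rw [show m + 2 + 1 = m + 3 by omega, show m + 2 - 1 = m + 1 by omega, H.one] at f2
    linear_combination h (m + 2) ^ 2 * f1 - h (m + 4) ^ 2 * f2 - f
  | odd m e1 e2 e3 e4 =>
    have e := normEDS_odd b c d ((m + 2 : ℕ) : ℤ)
    rw [show ((m + 2 : ℕ) : ℤ) - 1 = ((m + 1 : ℕ) : ℤ) by push_cast; ring,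
      show ((m + 2 : ℕ) : ℤ) + 2 = ((m + 4 : ℕ) : ℤ) by push_cast; ring,
      show ((m + 2 : ℕ) : ℤ) + 1 = ((m + 3 : ℕ) : ℤ) by push_cast; ring,
      e1, e2, e3, e4] at e
    rw [show ((2 * (m + 2) + 1 : ℕ) : ℤ) = 2 * ((m + 2 : ℕ) : ℤ) + 1 by push_cast; ring, e]
    have f := H.mul (m + 3) (m + 2) (by omega) (by omega)
    have f1 := H.mul (m + 3) 1 le_rfl (by omega)
    have f2 := H.mul (m + 2) 1 le_rfl (by omega)
    rw [show m + 3 + (m + 2) = 2 * (m + 2) + 1 by omega, show m + 3 - (m + 2) = 1 by omega,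
      H.one] at f
    rw [show m + 3 + 1 = m + 4 by omega, show m + 3 - 1 = m + 2 by omega, H.one] at f1
    rw [show m + 2 + 1 = m + 3 by omega, show m + 2 - 1 = m + 1 by omega, H.one] at f2
    linear_combination h (m + 2) ^ 2 * f1 - h (m + 3) ^ 2 * f2 - f

/-- The third division polynomial. -/
def threeDiv (W : WeierstrassCurve F) (u : F) : F :=
  3 * u ^ 4 + W.b₂ * u ^ 3 + 3 * W.b₄ * u ^ 2 + 3 * W.b₆ * u + W.b₈

/-- The quotient of the fourth division polynomial by the second one. -/
def fourDiv (W : WeierstrassCurve F) (u : F) : F :=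
  (6 * u ^ 2 + W.b₂ * u + W.b₄) * threeDiv W u - twoDivSq W u ^ 2

/-- The induction for nets divides by terms, and `normEDS` is not known beforehand to be nonzero.
`stepSeq` is nonzero because the abscissas are distinct; identifying the two sequences transfers
this. -/
theorem isNet_normEDS (HX : IsAbscissaSeq W X) {b : F} (hb : b ^ 2 = twoDivSq W (X 1)) :
    IsNet X fun n => normEDS b (threeDiv W (X 1)) (fourDiv W (X 1)) n := by
  have H := isNet_stepSeq HX hb
  have e12 : (X 1 - X 2) * b ^ 2 = threeDiv W (X 1) := by
    have := HX.two (X 1)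
    rw [hb]
    simp only [biquad, threeDiv] at this ⊢
    linear_combination -this
  have h3 : stepSeq X b 3 = threeDiv W (X 1) := by
    rw [← e12]
    simp [stepSeq]
  have h4 : stepSeq X b 4 = fourDiv W (X 1) * b := by
    have s := H.mul 3 1 le_rfl (by omega)
    have hb0 : b ≠ 0 := H.ne_zero 2 (by omega)
    have hsum : (2 * X 1 - X 1 - X 3) * (X 2 - X 1) ^ 2 =
        -(twoDivSq W (X 1) + (X 2 - X 1) * (6 * X 1 ^ 2 + W.b₂ * X 1 + W.b₄)) := by
      -- Subtracting the values at w = X 1 + 1 and w = X 1 isolates the sum X 3 + X 1.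
      have q0 := HX.add_sub 2 1 (X 1 + 1) le_rfl (by omega)
      have q1 := HX.add_sub 2 1 (X 1) le_rfl (by omega)
      norm_num at q0 q1
      simp only [biquad, twoDivSq] at q0 q1 ⊢
      linear_combination q0 - q1
    simp only [Nat.reduceAdd, Nat.reduceSub, H.one, h3] at s
    change stepSeq X b 4 * b = _ at s
    apply mul_right_cancel₀ hb0
    rw [s, fourDiv, ← hb, ← e12]
    rw [← hb] at hsum
    linear_combination b ^ 4 * hsum
  convert! H using 1
  exact funext fun n => H.normEDS_eq rfl h3 h4 n

end Nets

/-! ### Abscissas of the multiples of a non-torsion point. -/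

section Multiples

variable {F : Type*} [Field F] {W : WeierstrassCurve.Affine F}

theorem eq_or_eq_neg_of_xCoord_eq {P Q : W.Point} (hP : P ≠ 0) (hQ : Q ≠ 0)
    (h : xCoord P = xCoord Q) : P = Q ∨ P = -Q := by
  rcases P with _ | ⟨x₁, y₁, h₁⟩
  · exact absurd rfl hP
  rcases Q with _ | ⟨x₂, y₂, h₂⟩
  · exact absurd rfl hQ
  exact Affine.Point.X_eq_iff.1 h

variable [DecidableEq F]

theorem nsmul_ne_zero_of_not_isOfFinAddOrder {P : W.Point} (hP : ¬ IsOfFinAddOrder P) {n : ℕ}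
    (hn : 1 ≤ n) : n • P ≠ 0 := fun h =>
  hP (isOfFinAddOrder_iff_nsmul_eq_zero.2 ⟨n, hn, h⟩)

theorem isAbscissaSeq_nsmul {P : W.Point} (hP : ¬ IsOfFinAddOrder P) :
    IsAbscissaSeq W fun n => xCoord (n • P) := by
  have h0 : ∀ n : ℕ, 1 ≤ n → n • P ≠ 0 := fun n => nsmul_ne_zero_of_not_isOfFinAddOrder hP
  have hne : ∀ m n : ℕ, 1 ≤ n → n < m → xCoord (n • P) ≠ xCoord (m • P) := by
    intro m n hn hnm h
    rcases eq_or_eq_neg_of_xCoord_eq (h0 n hn) (h0 m (by omega)) h with h | h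
    · exact h0 (m - n) (by omega) (by rw [sub_nsmul _ hnm.le, ← h, add_neg_cancel])
    · exact h0 (n + m) (by omega) (by rw [add_nsmul, h, neg_add_cancel])
  have hPP : P + P ≠ 0 := by
    rw [← two_nsmul]
    exact h0 2 (by omega)
  have hP0 : P ≠ 0 := by simpa using h0 1 le_rfl
  refine ⟨hne, fun m n w hn hnm => ?_, ?_, fun w => ?_⟩
  · rw [add_nsmul, sub_nsmul _ hnm.le, ← sub_eq_add_neg]
    exact xCoord_add_sub_mul _ _ (h0 m (by omega)) (h0 n hn) (hne m n hn hnm).symm w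
  · rw [one_nsmul]
    exact twoDivSq_ne_zero P hP0 hPP
  · rw [one_nsmul, two_nsmul]
    exact xCoord_two_nsmul P hP0 hPP w

end Multiples

/-! ### Values of division polynomials on the curve. -/

section DivisionPolynomials

variable {F : Type*} [Field F] {W : WeierstrassCurve F}

theorem evalEval_ψ (W : WeierstrassCurve F) (x y : F) (n : ℤ) :
    (W.ψ n).evalEval x y =
      normEDS (2 * y + W.a₁ * x + W.a₃) (threeDiv W x) (fourDiv W x) n := by
  have h := map_normEDS (evalEvalRingHom x y) W.ψ₂ (C W.Ψ₃) (C W.preΨ₄) n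
  simp only [coe_evalEvalRingHom] at h
  rw [WeierstrassCurve.ψ, h]
  congr 1
  · rw [ψ₂, Affine.evalEval_polynomialY]
  · simp [Ψ₃, threeDiv, evalEval]
  · simp only [preΨ₄, fourDiv, threeDiv, twoDivSq, evalEval, eval_C, eval_add, eval_mul, eval_pow,
      eval_X, eval_ofNat]
    linear_combination x ^ 2 * W.b_relation

theorem isNet_ψ [DecidableEq F] {x y : F} (h : W.toAffine.Nonsingular x y)
    (hP : ¬ IsOfFinAddOrder (Affine.Point.some x y h)) :
    IsNet (fun n => xCoord (n • Affine.Point.some x y h)) fun n => (W.ψ n).evalEval x y := by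
  have hX := isAbscissaSeq_nsmul hP
  have hx : xCoord (1 • Affine.Point.some x y h) = x := by rw [one_nsmul]; rfl
  have H := isNet_normEDS hX (b := 2 * y + W.a₁ * x + W.a₃) (by
    simp only [hx]
    exact (twoDivSq_eq h.1).symm)
  simp only [hx] at H
  simpa only [evalEval_ψ] using H

theorem evalEval_eq_of_mk_eq {x y : F} (h : W.toAffine.Equation x y) {p q : F[X][X]}
    (hpq : Affine.CoordinateRing.mk W.toAffine p = Affine.CoordinateRing.mk W.toAffine q) :
    p.evalEval x y = q.evalEval x y := by
  obtain ⟨r, hr⟩ := AdjoinRoot.mk_eq_mk.1 hpq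
  have := congrArg (evalEval x y) hr
  rw [evalEval_sub, evalEval_mul, show W.toAffine.polynomial.evalEval x y = 0 from h, zero_mul] at this
  exact sub_eq_zero.1 this

theorem evalEval_ψ_sq {x y : F} (h : W.toAffine.Equation x y) (n : ℤ) :
    (W.ψ n).evalEval x y ^ 2 = (W.ΨSq n).eval x := by
  rw [← evalEval_pow, ← evalEval_C x y (W.ΨSq n)]
  refine evalEval_eq_of_mk_eq h ?_
  rw [map_pow, Affine.CoordinateRing.mk_ψ, Affine.CoordinateRing.mk_Ψ_sq]

theorem evalEval_φ {x y : F} (h : W.toAffine.Equation x y) (n : ℤ) :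
    x * (W.ψ n).evalEval x y ^ 2 - (W.ψ (n + 1)).evalEval x y * (W.ψ (n - 1)).evalEval x y =
      (W.Φ n).eval x := by
  have := evalEval_eq_of_mk_eq h (Affine.CoordinateRing.mk_φ (W := W) n)
  rw [evalEval_C] at this
  rw [← this, WeierstrassCurve.φ, evalEval_sub, evalEval_mul, evalEval_mul, evalEval_pow,
    evalEval_C, eval_X]

end DivisionPolynomials

/-! ### Clearing denominators in polynomial values. -/

section ClearDenominators

theorem exists_int_eq_pow_mul_eval (p : ℤ[X]) {N : ℕ} (hN : p.natDegree ≤ N) {A D : ℤ} {x : ℚ}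
    (hD : D ≠ 0) (hx : x * D = A) :
    ∃ z : ℤ, (z : ℚ) = (D : ℚ) ^ N * (p.map (Int.castRingHom ℚ)).eval x := by
  have hD' : (D : ℚ) ≠ 0 := by exact_mod_cast hD
  obtain ⟨z, b, hb, hz⟩ := denomsClearable_of_natDegree_le (i := Int.castRingHom ℚ) N A
    (b := D) (bi := (D : ℚ)⁻¹) (by simp [hD']) p hN
  refine ⟨z, ?_⟩
  simp only [eq_intCast] at hb hz
  rw [hz, eq_inv_of_mul_eq_one_left hb, ← div_eq_mul_inv, ← hx, mul_div_cancel_right₀ _ hD']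

/-- Without its leading term the polynomial has degree below N, so clearing denominators leaves a
spare factor D. -/
theorem exists_int_eq_pow_add_mul (p : ℤ[X]) {N : ℕ} (hN : p.natDegree ≤ N) (hm : p.coeff N = 1)
    (h1 : 1 ≤ N) {A D : ℤ} {x : ℚ} (hD : D ≠ 0) (hx : x * D = A) :
    ∃ z : ℤ, ((A ^ N + D * z : ℤ) : ℚ) = (D : ℚ) ^ N * (p.map (Int.castRingHom ℚ)).eval x := by
  obtain ⟨M, rfl⟩ := Nat.exists_eq_add_of_le' h1
  have hd : (p - X ^ (M + 1)).natDegree ≤ M := by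
    rw [natDegree_le_iff_coeff_eq_zero]
    intro k hk
    rw [coeff_sub, coeff_X_pow]
    split_ifs with h
    · rw [h, hm, sub_self]
    · rw [coeff_eq_zero_of_natDegree_lt (by omega), sub_zero]
  obtain ⟨z, hz⟩ := exists_int_eq_pow_mul_eval _ hd hD hx
  refine ⟨z, ?_⟩
  push_cast
  rw [hz, ← hx]
  simp only [Polynomial.map_sub, Polynomial.map_pow, map_X, eval_sub, eval_pow, eval_X]
  ring

theorem exists_int_of_sq_add_mul {q : ℚ} {m r : ℤ} (h : q ^ 2 + m * q = r) :
    ∃ z : ℤ, (z : ℚ) = q := by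
  have hint : _root_.IsIntegral ℤ q := by
    refine ⟨X ^ 2 + (C m * X - C r), ?_, ?_⟩
    · apply Polynomial.monic_X_pow_add
      compute_degree!
    · simp only [eval₂_add, eval₂_sub, eval₂_mul, eval₂_X_pow, eval₂_X, eval₂_C,
        algebraMap_int_eq, Int.coe_castRingHom]
      linear_combination h
  exact IsIntegrallyClosed.isIntegral_iff.1 hint

theorem exists_int_of_sq {q : ℚ} {z : ℤ} (h : (z : ℚ) = q ^ 2) : ∃ w : ℤ, (w : ℚ) = q :=
  exists_int_of_sq_add_mul (m := 0) (r := z) (by rw [h]; simp)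

end ClearDenominators

/-! ### The integral sequence H attached to a rational point. -/

section IntegralModel

variable {W : WeierstrassCurve ℤ}

/-- The ordinate of a point, with the value `0` at the point at infinity. -/
def yCoord : RatPoint W → ℚ
  | .zero => 0
  | .some _ y _ => y

/-- `(x, y) = (A / B ^ 2, C / B ^ 3)` in lowest terms are the coordinates of `P ≠ O`. -/
structure IsIntCoords (P : RatPoint W) (A B C : ℤ) : Prop where
  ne_zero : P ≠ 0
  pos : 0 < B
  isCoprime : IsCoprime A B
  x_mul : xCoord P * B ^ 2 = A
  y_mul : yCoord P * B ^ 3 = C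
  eqn : C ^ 2 + W.a₁ * A * B * C + W.a₃ * B ^ 3 * C =
    A ^ 3 + W.a₂ * A ^ 2 * B ^ 2 + W.a₄ * A * B ^ 4 + W.a₆ * B ^ 6
  denomRoot_eq : (denomRoot P : ℤ) = B

theorem exists_isIntCoords {P : RatPoint W} (hP : P ≠ 0) : ∃ A B C : ℤ, IsIntCoords P A B C := by
  rcases P with _ | ⟨x, y, h⟩
  · exact absurd rfl hP
  have hsq := denomRoot_sq x y h
  set b := denomRoot (W := W) (.some x y h) with hb
  have hbpos : 0 < b := by
    rcases Nat.eq_zero_or_pos b with h0 | h0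
    · rw [h0] at hsq
      exact absurd hsq.symm (by simp)
    · exact h0
  have hx : x * (b : ℚ) ^ 2 = x.num := by
    rw [show (b : ℚ) ^ 2 = (x.den : ℚ) by exact_mod_cast hsq, Rat.mul_den_eq_num]
  have he := (Affine.equation_iff x y).1 h.1
  simp only [WeierstrassCurve.baseChange, WeierstrassCurve.map, algebraMap_int_eq, eq_intCast] at he
  set A : ℤ := x.num
  have hY : (y * b ^ 3) ^ 2 + ((W.a₁ * A * b + W.a₃ * b ^ 3 : ℤ) : ℚ) * (y * b ^ 3) =
      ((A ^ 3 + W.a₂ * A ^ 2 * b ^ 2 + W.a₄ * A * b ^ 4 + W.a₆ * b ^ 6 : ℤ) : ℚ) := by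
    push_cast
    rw [← hx]
    linear_combination (b : ℚ) ^ 6 * he
  obtain ⟨c, hc⟩ := exists_int_of_sq_add_mul hY
  rw [← hc] at hY
  refine ⟨A, b, c, hP, by exact_mod_cast hbpos, ?_, hx, hc.symm, ?_, rfl⟩
  · have : IsCoprime A ((b : ℤ) ^ 2) := by
      rw [Int.isCoprime_iff_gcd_eq_one, show (b : ℤ) ^ 2 = (x.den : ℤ) by exact_mod_cast hsq]
      exact x.reduced
    exact (IsCoprime.pow_right_iff two_pos).1 this
  · have hZ : c ^ 2 + (W.a₁ * A * b + W.a₃ * b ^ 3) * c =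
      A ^ 3 + W.a₂ * A ^ 2 * b ^ 2 + W.a₄ * A * b ^ 4 + W.a₆ * b ^ 6 := by exact_mod_cast hY
    linear_combination hZ

/-- The numbers `H n = B ^ (n ^ 2 - 1) * ψ n` are integers. This collects their properties. -/
structure IsIntModel (P : RatPoint W) (A B C : ℤ) (H : ℕ → ℤ) : Prop extends
    IsIntCoords P A B C where
  mul_eq : ∀ n : ℕ, (B : ℚ) * H n = B ^ n ^ 2 * divPolyValue n P
  zero : H 0 = 0
  one : H 1 = 1
  two : H 2 = 2 * C + W.a₁ * A * B + W.a₃ * B ^ 3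
  three : H 3 = 3 * A ^ 4 + W.b₂ * A ^ 3 * B ^ 2 + 3 * W.b₄ * A ^ 2 * B ^ 4 +
    3 * W.b₆ * A * B ^ 6 + W.b₈ * B ^ 8
  four : H 4 = H 2 * ((6 * A ^ 2 + W.b₂ * A * B ^ 2 + W.b₄ * B ^ 4) * H 3 - H 2 ^ 4)
  rel : ∀ m n r : ℕ, r ≤ n → n ≤ m →
    H (m + n) * H (m - n) * H r ^ 2 =
      H (m + r) * H (m - r) * H n ^ 2 - H (n + r) * H (n - r) * H m ^ 2
  x_nsmul : ∀ n : ℕ, 1 ≤ n → xCoord (n • P) * (B * H n) ^ 2 =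
    (A * H n ^ 2 - H (n + 1) * H (n - 1) : ℤ)
  num_congr : ∀ n : ℕ, 1 ≤ n → B ^ 2 ∣ A * H n ^ 2 - H (n + 1) * H (n - 1) - A ^ n ^ 2

/-- On the curve ψ_n² is a polynomial in x of degree at most n² - 1, so the square of B^(n²-1) ψ_n
is an integer, hence so is the number itself. The congruence for the numerator holds because Φ_n is
monic of degree n². -/
theorem exists_intModel {P : RatPoint W} (hP : ¬ IsOfFinAddOrder P) {A B C : ℤ}
    (hc : IsIntCoords P A B C) : ∃ H : ℕ → ℤ, IsIntModel P A B C H := by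
  have hB : (B : ℚ) ≠ 0 := by exact_mod_cast hc.pos.ne'
  obtain ⟨x, y, h, rfl⟩ : ∃ x y h, P = Affine.Point.some x y h := by
    rcases P with _ | ⟨x, y, h⟩
    · exact absurd rfl hc.ne_zero
    · exact ⟨x, y, h, rfl⟩
  have hx : x * B ^ 2 = A := hc.x_mul
  have hy : y * B ^ 3 = C := hc.y_mul
  have hx' : x * (B ^ 2 : ℤ) = A := by exact_mod_cast hx
  have hB2 : B ^ 2 ≠ 0 := pow_ne_zero 2 hc.pos.ne'
  have N := isNet_ψ h hP
  set ψ : ℕ → ℚ := fun n => ((W.baseChange ℚ).ψ (n : ℤ)).evalEval x y with hψ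
  have sq : ∀ n, ψ n ^ 2 = (((W.ΨSq n).map (Int.castRingHom ℚ)).eval x) := fun n => by
    have := evalEval_ψ_sq h.1 n
    simp only [WeierstrassCurve.baseChange, map_ΨSq] at this
    exact this
  have phi : ∀ n : ℕ, 1 ≤ n → x * ψ n ^ 2 - ψ (n + 1) * ψ (n - 1) =
      (((W.Φ n).map (Int.castRingHom ℚ)).eval x) := fun n hn => by
    have := evalEval_φ h.1 n
    simp only [WeierstrassCurve.baseChange, map_Φ] at this
    simp only [hψ]
    rw [Nat.cast_sub hn]
    push_cast
    exact this
  have hint : ∀ n : ℕ, ∃ z : ℤ, (z : ℚ) = B ^ (n ^ 2 - 1) * ψ n := fun n => by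
    obtain ⟨z, hz⟩ := exists_int_eq_pow_mul_eval (W.ΨSq n) (N := n ^ 2 - 1)
      (W.natDegree_ΨSq_le n) hB2 hx'
    refine exists_int_of_sq (z := z) ?_
    rw [hz, ← sq]
    push_cast
    ring
  choose H hH using hint
  have hmul : ∀ n : ℕ, (B : ℚ) * H n = B ^ n ^ 2 * ψ n := fun n => by
    -- At n = 0 the exponent n² - 1 is truncated, but both sides vanish.
    rcases Nat.eq_zero_or_pos n with rfl | hn
    · rw [hH, N.zero]
      simp
    · rw [hH, ← mul_assoc, ← pow_succ', Nat.sub_add_cancel (Nat.one_le_pow _ _ hn)]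
  have h2 : (H 2 : ℚ) = 2 * C + W.a₁ * A * B + W.a₃ * B ^ 3 := by
    rw [hH, hψ]
    simp only [evalEval_ψ, Nat.cast_ofNat, normEDS_two]
    simp only [WeierstrassCurve.baseChange, map_a₁, map_a₃, algebraMap_int_eq, eq_intCast]
    rw [← hx, ← hy]
    norm_num
    ring
  have h3 : (H 3 : ℚ) = 3 * A ^ 4 + W.b₂ * A ^ 3 * B ^ 2 + 3 * W.b₄ * A ^ 2 * B ^ 4 +
      3 * W.b₆ * A * B ^ 6 + W.b₈ * B ^ 8 := by
    rw [hH, hψ]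
    simp only [evalEval_ψ, Nat.cast_ofNat, normEDS_three, threeDiv]
    simp only [WeierstrassCurve.baseChange, map_b₂, map_b₄, map_b₆, map_b₈, algebraMap_int_eq,
      eq_intCast]
    rw [← hx]
    norm_num
    ring
  have h4 : (H 4 : ℚ) =
      H 2 * ((6 * A ^ 2 + W.b₂ * A * B ^ 2 + W.b₄ * B ^ 4) * H 3 - H 2 ^ 4) := by
    have hs := twoDivSq_eq h.1
    have e : ∀ u v : ℚ, fourDiv (W.baseChange ℚ) x * u = v → v =
      ((6 * x ^ 2 + (W.baseChange ℚ).b₂ * x + (W.baseChange ℚ).b₄) *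
        threeDiv (W.baseChange ℚ) x - twoDivSq (W.baseChange ℚ) x ^ 2) * u :=
      fun u v h => by rw [← h, fourDiv]
    simp only [hH, hψ, evalEval_ψ, Nat.cast_ofNat, normEDS_two, normEDS_three, normEDS_four]
    rw [e _ _ rfl, hs]
    simp only [WeierstrassCurve.baseChange, map_b₂, map_b₄, algebraMap_int_eq, eq_intCast]
    rw [← hx]
    norm_num
    ring
  have hrel : ∀ m n r : ℕ, r ≤ n → n ≤ m →
      H (m + n) * H (m - n) * H r ^ 2 =
        H (m + r) * H (m - r) * H n ^ 2 - H (n + r) * H (n - r) * H m ^ 2 := by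
    intro m n r hr hn
    have R := N.rel hr hn
    obtain ⟨j, rfl⟩ := Nat.exists_eq_add_of_le hr
    obtain ⟨k, rfl⟩ := Nat.exists_eq_add_of_le hn
    rw [show r + j + k - (r + j) = k by omega, show r + j + k - r = j + k by omega,
      show r + j - r = j by omega] at R ⊢
    have hB4 : (B : ℚ) ^ 4 ≠ 0 := pow_ne_zero 4 hB
    have key : (B : ℚ) ^ 4 * (H (r + j + k + (r + j)) * H k * H r ^ 2) =
        (B : ℚ) ^ 4 * (H (r + j + k + r) * H (j + k) * H (r + j) ^ 2 -
          H (r + j + r) * H j * H (r + j + k) ^ 2) := by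
      calc _ = (B * H (r + j + k + (r + j))) * (B * H k) * ((B : ℚ) * H r) ^ 2 := by ring
        -- All three terms of the relation have this weight, since (m + n)² + (m - n)² = 2m² + 2n².
        _ = (B : ℚ) ^ (2 * (r + j + k) ^ 2 + 2 * (r + j) ^ 2 + 2 * r ^ 2) *
            (ψ (r + j + k + (r + j)) * ψ k * ψ r ^ 2) := by
          rw [hmul, hmul, hmul]
          ring
        _ = (B * H (r + j + k + r)) * (B * H (j + k)) * ((B : ℚ) * H (r + j)) ^ 2 -
            (B * H (r + j + r)) * (B * H j) * ((B : ℚ) * H (r + j + k)) ^ 2 := by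
          rw [R, hmul, hmul, hmul, hmul, hmul, hmul]
          ring
        _ = _ := by ring
    exact_mod_cast mul_left_cancel₀ hB4 key
  have hφ : ∀ n : ℕ, 1 ≤ n → ((A * H n ^ 2 - H (n + 1) * H (n - 1) : ℤ) : ℚ) =
      B ^ (2 * n ^ 2) * (x * ψ n ^ 2 - ψ (n + 1) * ψ (n - 1)) := by
    intro n hn
    obtain ⟨k, rfl⟩ := Nat.exists_eq_add_of_le' hn
    rw [Nat.add_sub_cancel]
    have hB2q : (B : ℚ) ^ 2 ≠ 0 := pow_ne_zero 2 hB
    apply mul_left_cancel₀ hB2q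
    push_cast
    calc _ = A * ((B : ℚ) * H (k + 1)) ^ 2 - (B * H (k + 1 + 1)) * (B * H k) := by ring
      _ = _ := by
        rw [hmul, hmul, hmul, ← hx]
        ring
  refine ⟨H, hc, hmul, ?_, ?_, by exact_mod_cast h2, by exact_mod_cast h3, by exact_mod_cast h4,
    hrel, fun n hn => ?_, fun n hn => ?_⟩
  · have := hH 0
    rw [N.zero, mul_zero] at this
    exact_mod_cast this
  · have := hH 1
    rw [N.one] at this
    norm_num at this
    exact this
  · have := N.mul n 1 le_rfl hn
    rw [N.one, one_nsmul] at this
    rw [hφ n hn, this, hmul]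
    change _ = _ * (x * ψ n ^ 2 - (x - _) * _ * _)
    ring
  · obtain ⟨z, hz⟩ := exists_int_eq_pow_add_mul (W.Φ n) (N := n ^ 2)
      (W.natDegree_Φ_le n) (by simpa using W.coeff_Φ n)
      (Nat.one_le_pow _ _ hn) hB2 hx'
    refine ⟨z, ?_⟩
    have e := hφ n hn
    rw [phi n hn, pow_mul] at e
    rw [Int.cast_pow, ← e] at hz
    have := Int.cast_injective hz
    linear_combination -this

end IntegralModel

/-! ### How far the abscissas determine a net. -/

section NetUniqueness

variable {F : Type*} [Field F] {X g h : ℕ → F}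

theorem IsNet.three_eq (H : IsNet X g) : g 3 = (X 1 - X 2) * g 2 ^ 2 := by
  have := H.mul 2 1 le_rfl (by omega)
  norm_num [H.one] at this
  exact this

/-- The term g 5 is computed in two ways, from (4, 1) and from (3, 2). This pins down `g 2 ^ 2` in
terms of X alone, so two nets over the same X can be compared. -/
theorem IsNet.mul_two_sq (H : IsNet X g) :
    (X 2 - X 3) * g 2 ^ 2 = (X 1 - X 4) * (X 1 - X 3) ^ 2 * (X 1 - X 2) := by
  have e3 := H.three_eq
  have e4 := H.mul 3 1 le_rfl (by omega)
  have e5 := H.mul 4 1 le_rfl (by omega)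
  have e5' := H.mul 3 2 (by omega) (by omega)
  norm_num [H.one] at e4 e5 e5'
  have n2 := H.ne_zero 2 (by omega)
  have n3 := H.ne_zero 3 (by omega)
  apply mul_left_cancel₀ (mul_ne_zero (pow_ne_zero 3 n3) (pow_ne_zero 2 n2))
  calc g 3 ^ 3 * g 2 ^ 2 * ((X 2 - X 3) * g 2 ^ 2)
      = ((X 2 - X 3) * g 3 ^ 2 * g 2 ^ 2) * g 3 * g 2 ^ 2 := by ring
    _ = (X 1 - X 4) * (g 4 * g 2) ^ 2 := by rw [← e5', e5]; ring
    _ = (X 1 - X 4) * (X 1 - X 3) ^ 2 * g 3 ^ 3 * g 3 := by rw [e4]; ring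
    _ = _ := by nth_rewrite 2 [e3]; ring

theorem IsNet.two_sq_eq (Hg : IsNet X g) (Hh : IsNet X h) : g 2 ^ 2 = h 2 ^ 2 := by
  have hX : X 2 - X 3 ≠ 0 := fun h0 => by
    have := Hg.mul 3 2 (by omega) (by omega)
    rw [h0, zero_mul, zero_mul] at this
    exact mul_ne_zero (Hg.ne_zero 5 (by omega)) (Hg.ne_zero 1 le_rfl) this
  exact mul_left_cancel₀ hX (Hg.mul_two_sq.trans Hh.mul_two_sq.symm)

theorem IsNet.three_eq_three (Hg : IsNet X g) (Hh : IsNet X h) : g 3 = h 3 := by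
  rw [Hg.three_eq, Hh.three_eq, Hg.two_sq_eq Hh]

theorem IsNet.comp_mul (H : IsNet X h) {k : ℕ} (hk : 1 ≤ k) :
    IsNet (fun n => X (n * k)) fun n => h (n * k) / h k ^ n ^ 2 := by
  have hk0 := H.ne_zero k hk
  refine ⟨by simp [H.zero], by simp [hk0], fun n hn => ?_, fun m n hn hnm => ?_⟩
  · exact div_ne_zero (H.ne_zero _ (Nat.mul_pos hn hk)) (pow_ne_zero _ hk0)
  · have := H.mul (m * k) (n * k) (Nat.mul_pos hn hk) (Nat.mul_le_mul_right k hnm)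
    rw [← add_mul, ← Nat.sub_mul] at this
    obtain ⟨j, rfl⟩ := Nat.exists_eq_add_of_le hnm
    rw [Nat.add_sub_cancel_left] at this ⊢
    have e : h k ^ (n + j + n) ^ 2 * h k ^ j ^ 2 =
        (h k ^ (n + j) ^ 2) ^ 2 * (h k ^ n ^ 2) ^ 2 := by ring
    rw [div_mul_div_comm, this, e, div_pow, div_pow]
    field_simp

end NetUniqueness

/-! ### Zeros of elliptic sequences over a field. -/

section ZerosOverField

variable {K : Type*} [Field K] {h : ℕ → K}

/-- Descent to a pair of zeros preceded by a nonzero term h (n - 1). For n ≥ 4 the instance (n - 1,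
2) gives h 3 = 0, and (n, 2) gives h (n + 2) = 0 or h (n - 2) = 0. In the first case (n - 1, 3)
yields h 4 * h 2 = 0; in the second, (n - 2, 2) yields h 2 = 0 or an earlier pair of zeros. -/
theorem eq_zero_of_consecutive_zeros (h1 : h 1 = 1)
    (rel : ∀ m n : ℕ, 1 ≤ n → n ≤ m → h (m + n) * h (m - n) =
      h (m + 1) * h (m - 1) * h n ^ 2 - h (n + 1) * h (n - 1) * h m ^ 2)
    (h4 : h 3 = 0 → h 4 = 0 → h 2 = 0) (n : ℕ) (hn : 1 ≤ n) (a : h n = 0) (b : h (n + 1) = 0) :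
    h 2 = 0 ∧ h 3 = 0 := by
  induction n using Nat.strong_induction_on with
  | _ n ih =>
    by_cases hprev : n - 1 ≥ 1 ∧ h (n - 1) = 0
    · exact ih (n - 1) (by omega) hprev.1 hprev.2 (by rwa [Nat.sub_add_cancel hn])
    obtain rfl | rfl | rfl | ⟨k, rfl⟩ : n = 1 ∨ n = 2 ∨ n = 3 ∨ ∃ k, n = k + 4 := by
      rcases n with _ | _ | _ | _ | k
      · omega
      · simp
      · simp
      · simp
      · exact Or.inr (Or.inr (Or.inr ⟨k, rfl⟩))
    · exact absurd a (by rw [h1]; exact one_ne_zero)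
    · exact ⟨a, b⟩
    · exact ⟨h4 a b, a⟩
    have hp : h (k + 3) ≠ 0 := fun h0 => hprev ⟨by omega, h0⟩
    have r1 := rel (k + 3) 2 (by omega) (by omega)
    have r2 := rel (k + 3) 3 (by omega) (by omega)
    have r3 := rel (k + 4) 2 (by omega) (by omega)
    have r4 := rel (k + 2) 2 (by omega) (by omega)
    simp only [show k + 3 - 2 = k + 1 by omega, show k + 3 - 1 = k + 2 by omega,
      show k + 3 - 3 = k by omega, show k + 4 - 2 = k + 2 by omega,
      show k + 4 - 1 = k + 3 by omega, show k + 2 - 2 = k by omega, show k + 2 - 1 = k + 1 by omega,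
      add_assoc, Nat.reduceAdd, Nat.reduceSub] at r1 r2 r3 r4 a b
    rw [h1, b, a] at r1
    have h3 : h 3 = 0 := by
      have : h 3 * h (k + 3) ^ 2 = 0 := by linear_combination r1
      exact (mul_eq_zero.1 this).resolve_right (pow_ne_zero 2 hp)
    refine ⟨?_, h3⟩
    rw [a, h3] at r2
    rw [b, h3, zero_mul, zero_mul, zero_mul, zero_mul, sub_zero] at r3
    rw [a, h3] at r4
    rcases mul_eq_zero.1 r3 with h0 | h0
    · have : h 4 * h 2 * h (k + 3) ^ 2 = 0 := by
        rw [h0] at r2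
        linear_combination r2
      rcases mul_eq_zero.1 ((mul_eq_zero.1 this).resolve_right (pow_ne_zero 2 hp)) with h5 | h5
      · exact h4 h3 h5
      · exact h5
    · have : h (k + 3) * (h (k + 1) * h 2 ^ 2) = 0 := by linear_combination -r4
      rcases mul_eq_zero.1 ((mul_eq_zero.1 this).resolve_left hp) with h5 | h5
      · exact (ih (k + 1) (by omega) (by omega) h5 h0).1
      · exact pow_eq_zero_iff two_ne_zero |>.1 h5

/-- Let ρ be the least positive zero. The instance (m, ρ) makes h (m + ρ) * h (m - ρ) a nonzero
multiple of h m ^ 2, so non-vanishing propagates from the residues 0 < s < ρ along steps of ρ. -/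
theorem exists_dvd_of_zero (h1 : h 1 = 1)
    (rel : ∀ m n : ℕ, 1 ≤ n → n ≤ m → h (m + n) * h (m - n) =
      h (m + 1) * h (m - 1) * h n ^ 2 - h (n + 1) * h (n - 1) * h m ^ 2)
    (hc : ∀ n : ℕ, 1 ≤ n → h n = 0 → h (n + 1) ≠ 0) (hz : ∃ n, 1 ≤ n ∧ h n = 0) :
    ∃ ρ, 1 ≤ ρ ∧ h ρ = 0 ∧ ∀ n, h n = 0 → ρ ∣ n := by
  classical
  obtain ⟨hρ1, hρ⟩ := Nat.find_spec hz
  have hmin : ∀ m, 1 ≤ m → m < Nat.find hz → h m ≠ 0 := fun m hm hlt h0 =>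
    Nat.find_min hz hlt ⟨hm, h0⟩
  set ρ := Nat.find hz
  have hρ2 : 2 ≤ ρ := by
    rcases hρ1.eq_or_lt with h0 | h0
    · rw [← h0, h1] at hρ
      exact absurd hρ one_ne_zero
    · exact h0
  have hu : h (ρ + 1) * h (ρ - 1) ≠ 0 :=
    mul_ne_zero (hc ρ hρ1 hρ) (hmin _ (by omega) (by omega))
  refine ⟨ρ, hρ1, hρ, fun n hn => ?_⟩
  by_contra hd
  have key : ∀ j, h (n % ρ + ρ * j) ≠ 0 := by
    have hs1 : 1 ≤ n % ρ := Nat.pos_of_ne_zero fun h0 => hd (Nat.dvd_of_mod_eq_zero h0)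
    have hs2 : n % ρ < ρ := Nat.mod_lt _ hρ1
    generalize n % ρ = s at hs1 hs2
    intro j
    induction j with
    | zero => exact hmin s hs1 hs2
    | succ j ih =>
      intro h0
      rcases j with _ | j
      · have := rel ρ s hs1 hs2.le
        rw [show ρ + s = s + ρ * (0 + 1) by ring, h0, hρ] at this
        have e : h (ρ + 1) * h (ρ - 1) * h s ^ 2 = 0 := by linear_combination -this
        exact mul_ne_zero hu (pow_ne_zero 2 (hmin s hs1 hs2)) e
      · have hle : ρ ≤ s + ρ * (j + 1) := by nlinarith
        have := rel (s + ρ * (j + 1)) ρ hρ1 hle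
        rw [show s + ρ * (j + 1) + ρ = s + ρ * (j + 1 + 1) by ring, h0, hρ] at this
        have e : h (ρ + 1) * h (ρ - 1) * h (s + ρ * (j + 1)) ^ 2 = 0 := by linear_combination this
        exact mul_ne_zero hu (pow_ne_zero 2 ih) e
  exact key (n / ρ) (by rwa [Nat.mod_add_div])

end ZerosOverField

/-! ### Smooth reduction and lowest terms. -/

section Reduction

variable {W : WeierstrassCurve ℤ} {P : RatPoint W} {A B C : ℤ} {H : ℕ → ℤ} {p : ℕ}

/-- The homogenized partial derivative of the Weierstrass equation with respect to `x`. -/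
def partialX (W : WeierstrassCurve ℤ) (A B C : ℤ) : ℤ :=
  W.a₁ * B * C - (3 * A ^ 2 + 2 * W.a₂ * A * B ^ 2 + W.a₄ * B ^ 4)

/-- The homogenized partial derivative of the Weierstrass equation with respect to `y`. -/
def partialY (W : WeierstrassCurve ℤ) (A B C : ℤ) : ℤ :=
  2 * C + W.a₁ * A * B + W.a₃ * B ^ 3

/-- The point `(A / B ^ 2, C / B ^ 3)` has non-singular reduction modulo `p`. -/
def IsSmoothAt (W : WeierstrassCurve ℤ) (p : ℕ) (A B C : ℤ) : Prop :=
  ¬ ((p : ℤ) ∣ partialX W A B C ∧ (p : ℤ) ∣ partialY W A B C)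

theorem IsIntCoords.not_dvd_left (hc : IsIntCoords P A B C) (hp : p.Prime) (hB : (p : ℤ) ∣ B) :
    ¬ (p : ℤ) ∣ A := fun hA =>
  (Nat.prime_iff_prime_int.1 hp).not_isUnit (hc.isCoprime.isUnit_of_dvd' hA hB)

/-- The reduction is the point at infinity. Modulo p the partials become -3A² and 2C, where C² ≡ A³
is a unit; p cannot divide both 3 and 2. -/
theorem IsIntCoords.isSmoothAt_of_dvd (hc : IsIntCoords P A B C) (hp : p.Prime)
    (hB : (p : ℤ) ∣ B) : IsSmoothAt W p A B C := by
  rintro ⟨hX, hY⟩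
  have hpi := Nat.prime_iff_prime_int.1 hp
  have hA := hc.not_dvd_left hp hB
  obtain ⟨k, rfl⟩ := hB
  have hC : ¬ (p : ℤ) ∣ C := fun ⟨l, hl⟩ => hA (hpi.dvd_of_dvd_pow (n := 3) (by
    have := hc.eqn
    refine ⟨l * C + W.a₁ * A * k * C + W.a₃ * p ^ 2 * k ^ 3 * C - W.a₂ * A ^ 2 * p * k ^ 2 -
      W.a₄ * A * p ^ 3 * k ^ 4 - W.a₆ * p ^ 5 * k ^ 6, ?_⟩
    linear_combination -this + C * hl))
  have h3 : (p : ℤ) ∣ 3 := by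
    have : (p : ℤ) ∣ 3 * A ^ 2 := by
      obtain ⟨l, hl⟩ := hX
      refine ⟨W.a₁ * k * C - 2 * W.a₂ * A * p * k ^ 2 - W.a₄ * p ^ 3 * k ^ 4 - l, ?_⟩
      rw [partialX] at hl
      linear_combination -hl
    exact (hpi.dvd_or_dvd this).resolve_right fun h => hA (hpi.dvd_of_dvd_pow h)
  have h2 : (p : ℤ) ∣ 2 := by
    have : (p : ℤ) ∣ 2 * C := by
      obtain ⟨l, hl⟩ := hY
      refine ⟨l - W.a₁ * A * k - W.a₃ * p ^ 2 * k ^ 3, ?_⟩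
      rw [partialY] at hl
      linear_combination hl
    exact (hpi.dvd_or_dvd this).resolve_right hC
  exact hpi.not_isUnit (isUnit_of_dvd_one (by simpa using dvd_sub h3 h2))

/-- Modulo H 2, which is the y-partial, H 3 is minus the square of the x-partial. So common
divisibility of H 2 and H 3 by a prime detects a singular reduction. -/
theorem IsIntModel.three_eq (M : IsIntModel P A B C H) :
    H 3 = H 2 ^ 2 * (3 * A + W.a₂ * B ^ 2) - partialX W A B C ^ 2 +
      W.a₁ * B * partialX W A B C * H 2 := by
  rw [M.three, M.two, partialX, b₂, b₄, b₆, b₈]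
  linear_combination (-12 * A - B ^ 2 * W.a₁ ^ 2 - 4 * B ^ 2 * W.a₂) * M.eqn

theorem IsIntModel.isSmoothAt_iff (M : IsIntModel P A B C H) (hp : p.Prime) :
    IsSmoothAt W p A B C ↔ ¬ ((p : ℤ) ∣ H 2 ∧ (p : ℤ) ∣ H 3) := by
  have hpi := Nat.prime_iff_prime_int.1 hp
  have h2 : partialY W A B C = H 2 := M.two.symm
  rw [IsSmoothAt, h2, not_iff_not]
  refine ⟨fun ⟨hX, hY⟩ => ⟨hY, ?_⟩, fun ⟨hY, hZ⟩ => ⟨hpi.dvd_of_dvd_pow (n := 2) ?_, hY⟩⟩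
  · rw [M.three_eq]
    exact dvd_add (dvd_sub ((hY.pow two_ne_zero).mul_right _) (hX.pow two_ne_zero))
      (hY.mul_left _)
  · have : partialX W A B C ^ 2 = H 2 * (H 2 * (3 * A + W.a₂ * B ^ 2) +
        W.a₁ * B * partialX W A B C) - H 3 := by
      linear_combination M.three_eq
    rw [this]
    exact dvd_sub (hY.mul_right _) hZ

theorem IsIntModel.rel_one (M : IsIntModel P A B C H) (m n : ℕ) (hn : 1 ≤ n) (hnm : n ≤ m) :
    H (m + n) * H (m - n) =
      H (m + 1) * H (m - 1) * H n ^ 2 - H (n + 1) * H (n - 1) * H m ^ 2 := by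
  simpa [M.one] using M.rel m n 1 hn hnm

theorem IsIntModel.rel_zmod (M : IsIntModel P A B C H) (p : ℕ) (m n : ℕ) (hn : 1 ≤ n)
    (hnm : n ≤ m) : (H (m + n) : ZMod p) * H (m - n) =
      H (m + 1) * H (m - 1) * (H n : ZMod p) ^ 2 - H (n + 1) * H (n - 1) * (H m : ZMod p) ^ 2 := by
  exact_mod_cast congrArg (Int.cast : ℤ → ZMod p) (M.rel_one m n hn hnm)

theorem IsIntModel.not_dvd_succ (M : IsIntModel P A B C H) (hp : p.Prime)
    (hs : IsSmoothAt W p A B C) {n : ℕ} (hn : 1 ≤ n) (h : (p : ℤ) ∣ H n) :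
    ¬ (p : ℤ) ∣ H (n + 1) := fun h' => by
  have := Fact.mk hp
  refine (M.isSmoothAt_iff hp).1 hs ?_
  simp only [← ZMod.intCast_zmod_eq_zero_iff_dvd] at h h' ⊢
  refine eq_zero_of_consecutive_zeros (h := fun n => (H n : ZMod p)) (by simp [M.one])
    (M.rel_zmod p) (fun h3 h4 => ?_) n hn h h'
  have e := congrArg (Int.cast : ℤ → ZMod p) M.four
  push_cast at e
  rw [h3, h4] at e
  -- When H 3 and H 4 vanish, the formula for H 4 reduces to H 2 ^ 5 = 0.
  exact pow_eq_zero_iff (n := 5) (by norm_num) |>.1 (by linear_combination e)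

theorem IsIntModel.not_dvd_num (M : IsIntModel P A B C H) (hp : p.Prime)
    (hs : IsSmoothAt W p A B C) {n : ℕ} (hn : 1 ≤ n) (h : (p : ℤ) ∣ B * H n) :
    ¬ (p : ℤ) ∣ A * H n ^ 2 - H (n + 1) * H (n - 1) := fun h' => by
  have hpi := Nat.prime_iff_prime_int.1 hp
  by_cases hB : (p : ℤ) ∣ B
  · refine M.not_dvd_left hp hB (hpi.dvd_of_dvd_pow (n := n ^ 2) ?_)
    simpa using dvd_sub h' ((hB.pow two_ne_zero).trans (M.num_congr n hn))
  have hH := (hpi.dvd_or_dvd h).resolve_left hB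
  have : (p : ℤ) ∣ H (n + 1) * H (n - 1) := by
    simpa using dvd_sub ((hH.pow two_ne_zero).mul_left A) h'
  have hprev := (hpi.dvd_or_dvd this).resolve_left (M.not_dvd_succ hp hs hn hH)
  rcases hn.eq_or_lt with rfl | hn
  · rw [M.one] at hH
    exact hpi.not_isUnit (isUnit_of_dvd_one hH)
  · exact M.not_dvd_succ hp hs (n := n - 1) (by omega) hprev (by rwa [Nat.sub_add_cancel (by omega)])

theorem IsIntModel.cross_mul (M : IsIntModel P A B C H) {n : ℕ} (hn : 1 ≤ n) {A' B' C' : ℤ}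
    (hc : IsIntCoords (n • P) A' B' C') :
    A' * (B * H n) ^ 2 = (A * H n ^ 2 - H (n + 1) * H (n - 1)) * B' ^ 2 := by
  have h := M.x_nsmul n hn
  have h' := hc.x_mul
  have : ((A' * (B * H n) ^ 2 : ℤ) : ℚ) =
      ((A * H n ^ 2 - H (n + 1) * H (n - 1)) * B' ^ 2 : ℤ) := by
    rw [Int.cast_mul, Int.cast_mul, ← h, ← h']
    push_cast
    ring
  exact_mod_cast this

theorem IsIntModel.dvd_iff (M : IsIntModel P A B C H) (hp : p.Prime)
    (hs : IsSmoothAt W p A B C) {n : ℕ} (hn : 1 ≤ n) {A' B' C' : ℤ}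
    (hc : IsIntCoords (n • P) A' B' C') : (p : ℤ) ∣ B' ↔ (p : ℤ) ∣ B * H n := by
  have hpi := Nat.prime_iff_prime_int.1 hp
  have e := M.cross_mul hn hc
  constructor <;> intro h
  · have : (p : ℤ) ∣ A' * (B * H n) ^ 2 := e ▸ (h.pow two_ne_zero).mul_left _
    exact hpi.dvd_of_dvd_pow ((hpi.dvd_or_dvd this).resolve_left (hc.not_dvd_left hp h))
  · have : (p : ℤ) ∣ (A * H n ^ 2 - H (n + 1) * H (n - 1)) * B' ^ 2 :=
      e ▸ (h.pow two_ne_zero).mul_left _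
    exact hpi.dvd_of_dvd_pow ((hpi.dvd_or_dvd this).resolve_left (M.not_dvd_num hp hs hn h))

/-- Both fractions for x(nP) are in lowest terms, so their denominators divide each other. -/
theorem IsIntModel.denomRoot_nsmul (M : IsIntModel P A B C H)
    (hP : ¬ IsOfFinAddOrder P) (hs : ∀ p : ℕ, p.Prime → IsSmoothAt W p A B C) (n : ℕ) :
    (denomRoot (n • P) : ℤ) = |B * H n| := by
  rcases Nat.eq_zero_or_pos n with rfl | hn
  · rw [zero_nsmul, M.zero, mul_zero, abs_zero]
    rfl
  obtain ⟨A', B', C', hc⟩ := exists_isIntCoords (nsmul_ne_zero_of_not_isOfFinAddOrder hP hn)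
  have e := M.cross_mul hn hc
  have hcop : IsCoprime ((B * H n) ^ 2) (A * H n ^ 2 - H (n + 1) * H (n - 1)) := by
    refine IsCoprime.pow_left ?_
    rw [Int.isCoprime_iff_gcd_eq_one, Int.gcd, ← Nat.coprime_iff_gcd_eq_one]
    refine Nat.coprime_of_dvd fun q hq h1 h2 => ?_
    exact M.not_dvd_num hq (hs q hq) hn (Int.natCast_dvd.2 h1) (Int.natCast_dvd.2 h2)
  have d1 : (B * H n) ^ 2 ∣ B' ^ 2 := hcop.dvd_of_dvd_mul_left (e ▸ dvd_mul_left _ _)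
  have d2 : B' ^ 2 ∣ (B * H n) ^ 2 :=
    (hc.isCoprime.pow_right (n := 2)).symm.dvd_of_dvd_mul_left (e ▸ dvd_mul_left _ _)
  have hab := Int.natAbs_eq_of_dvd_dvd ((Int.pow_dvd_pow_iff two_ne_zero).1 d1)
    ((Int.pow_dvd_pow_iff two_ne_zero).1 d2)
  rw [hc.denomRoot_eq, Int.abs_eq_natAbs, hab, Int.natAbs_of_nonneg hc.pos.le]

theorem IsIntModel.beta_eq (M : IsIntModel P A B C H)
    (hP : ¬ IsOfFinAddOrder P) (hs : ∀ p : ℕ, p.Prime → IsSmoothAt W p A B C) (n : ℕ) :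
    (H n : ℚ) = beta P n := by
  have hBZ := M.pos
  have hB : (0 : ℚ) < B := by exact_mod_cast hBZ
  have h1 : ((denomRoot (1 • P) : ℕ) : ℚ) = B := by
    rw [one_nsmul]
    exact_mod_cast M.denomRoot_eq
  have hn : ((denomRoot (n • P) : ℕ) : ℚ) = B * |(H n : ℚ)| := by
    have := M.denomRoot_nsmul hP hs n
    rw [abs_mul, abs_of_pos hBZ] at this
    exact_mod_cast this
  have hsign : SignType.sign (divPolyValue n P) = SignType.sign (H n : ℚ) := by
    have := congrArg SignType.sign (M.mul_eq n)
    rw [sign_mul, sign_mul, sign_pos hB, sign_pos (pow_pos hB _), one_mul, one_mul] at this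
    exact this.symm
  rw [beta, hsign, h1, hn, mul_div_cancel_left₀ _ hB.ne', sign_mul_abs]

theorem isRatWardEDS_beta_of_isSmoothAt (hP : ¬ IsOfFinAddOrder P) (hc : IsIntCoords P A B C)
    (hs : ∀ p : ℕ, p.Prime → IsSmoothAt W p A B C) : IsRatWardEDS (beta P) := by
  obtain ⟨H, M⟩ := exists_intModel hP hc
  refine ⟨H, M.beta_eq hP hs, M.zero, M.one, ?_, M.rel⟩
  rw [M.four]
  exact dvd_mul_right _ _

end Reduction

/-! ### Multiples of non-singular points; projective reduction. -/

section NonsingularReduction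

variable {W : WeierstrassCurve ℤ} {P : RatPoint W} {A B C : ℤ} {H : ℕ → ℤ} {p : ℕ}

theorem isNet_divPolyValue (hP : ¬ IsOfFinAddOrder P) :
    IsNet (fun n => xCoord (n • P)) fun n => divPolyValue n P := by
  rcases P with _ | ⟨x, y, h⟩
  · exact absurd IsOfFinAddOrder.zero hP
  · exact isNet_ψ h hP

theorem not_isOfFinAddOrder_nsmul (hP : ¬ IsOfFinAddOrder P) {k : ℕ} (hk : 1 ≤ k) :
    ¬ IsOfFinAddOrder (k • P) := fun h => hP (h.of_nsmul (by omega))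

/-- Both ψ_{nk}(P) / ψ_k(P)^(n²) and ψ_n(kP) are nets over the abscissas of the nkP. Uniqueness
gives equality at n = 3, but at n = 2 only of the squares, which suffices for divisibility. -/
theorem IsIntModel.chain_rule (M : IsIntModel P A B C H) (hP : ¬ IsOfFinAddOrder P) {k : ℕ}
    (hk : 1 ≤ k) {A' B' C' : ℤ} {H' : ℕ → ℤ} (M' : IsIntModel (k • P) A' B' C' H') :
    (B * H (2 * k)) ^ 2 * B' ^ 8 = (B' * H' 2) ^ 2 * (B * H k) ^ 8 ∧
      (B * H (3 * k)) * B' ^ 9 = (B' * H' 3) * (B * H k) ^ 9 := by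
  have N := isNet_divPolyValue hP
  have N1 := N.comp_mul hk
  have N2 := isNet_divPolyValue (not_isOfFinAddOrder_nsmul hP hk)
  simp only [← mul_nsmul'] at N2
  have e2 := N1.two_sq_eq N2
  have e3 := N1.three_eq_three N2
  have hk0 := N.ne_zero k hk
  have hk0' : divPolyValue k P ≠ 0 := hk0
  rw [div_pow, div_eq_iff (by positivity)] at e2
  rw [div_eq_iff (by positivity)] at e3
  constructor
  · have : ((((B * H (2 * k)) ^ 2 * B' ^ 8 : ℤ)) : ℚ) =
        ((B' * H' 2) ^ 2 * (B * H k) ^ 8 : ℤ) := by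
      push_cast
      rw [M.mul_eq, M.mul_eq, M'.mul_eq, mul_pow, e2]
      ring
    exact_mod_cast this
  · have : ((((B * H (3 * k)) * B' ^ 9 : ℤ)) : ℚ) = ((B' * H' 3) * (B * H k) ^ 9 : ℤ) := by
      push_cast
      rw [M.mul_eq, M.mul_eq, M'.mul_eq, e3]
      ring
    exact_mod_cast this

/-- If kP were singular, the chain rule would put 2k and 3k among the zeros of H modulo p, so the
rank ρ of p divides k. Then ρP reduces to infinity, and so does its multiple kP, which makes kP
smooth after all. -/
theorem IsSmoothAt.nsmul (hP : ¬ IsOfFinAddOrder P) (hc : IsIntCoords P A B C) (hp : p.Prime)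
    (hs : IsSmoothAt W p A B C) {k : ℕ} (hk : 1 ≤ k) {A' B' C' : ℤ}
    (hc' : IsIntCoords (k • P) A' B' C') : IsSmoothAt W p A' B' C' := by
  by_contra hns
  have hpi := Nat.prime_iff_prime_int.1 hp
  obtain ⟨H, M⟩ := exists_intModel hP hc
  obtain ⟨H', M'⟩ := exists_intModel (not_isOfFinAddOrder_nsmul hP hk) hc'
  have hB' : ¬ (p : ℤ) ∣ B' := fun h => hns (hc'.isSmoothAt_of_dvd hp h)
  have hBk : ¬ (p : ℤ) ∣ B * H k := fun h => hB' ((M.dvd_iff hp hs hk hc').2 h)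
  have hB : ¬ (p : ℤ) ∣ B := fun h => hBk (h.mul_right _)
  obtain ⟨h2', h3'⟩ := not_not.1 (mt (M'.isSmoothAt_iff hp).2 hns)
  obtain ⟨e2, e3⟩ := M.chain_rule hP hk M'
  have h2 : (p : ℤ) ∣ H (2 * k) := by
    have : (p : ℤ) ∣ (B * H (2 * k)) ^ 2 * B' ^ 8 :=
      e2 ▸ ((h2'.mul_left _).pow two_ne_zero).mul_right _
    have := (hpi.dvd_or_dvd this).resolve_right fun h => hB' (hpi.dvd_of_dvd_pow h)
    exact (hpi.dvd_or_dvd (hpi.dvd_of_dvd_pow this)).resolve_left hB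
  have h3 : (p : ℤ) ∣ H (3 * k) := by
    have : (p : ℤ) ∣ (B * H (3 * k)) * B' ^ 9 := e3 ▸ (h3'.mul_left _).mul_right _
    have := (hpi.dvd_or_dvd this).resolve_right fun h => hB' (hpi.dvd_of_dvd_pow h)
    exact (hpi.dvd_or_dvd this).resolve_left hB
  have := Fact.mk hp
  obtain ⟨ρ, hρ1, hρ0, hρ⟩ := exists_dvd_of_zero (h := fun n => (H n : ZMod p)) (by simp [M.one])
    (M.rel_zmod p) (fun n hn h h' => M.not_dvd_succ hp hs hn
      ((ZMod.intCast_zmod_eq_zero_iff_dvd _ _).1 h) ((ZMod.intCast_zmod_eq_zero_iff_dvd _ _).1 h'))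
    ⟨2 * k, by omega, (ZMod.intCast_zmod_eq_zero_iff_dvd _ _).2 h2⟩
  have hd : ρ ∣ k := by
    have := Nat.dvd_sub (hρ _ ((ZMod.intCast_zmod_eq_zero_iff_dvd _ _).2 h3))
      (hρ _ ((ZMod.intCast_zmod_eq_zero_iff_dvd _ _).2 h2))
    rwa [← Nat.sub_mul, show 3 - 2 = 1 from rfl, one_mul] at this
  obtain ⟨j, rfl⟩ := hd
  have hj : 1 ≤ j := Nat.pos_of_ne_zero (by rintro rfl; simp at hk)
  have hρP := not_isOfFinAddOrder_nsmul hP hρ1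
  obtain ⟨A₁, B₁, C₁, hc₁⟩ := exists_isIntCoords (nsmul_ne_zero_of_not_isOfFinAddOrder hP hρ1)
  obtain ⟨H₁, M₁⟩ := exists_intModel hρP hc₁
  have hB₁ : (p : ℤ) ∣ B₁ := (M.dvd_iff hp hs hρ1 hc₁).2
    (((ZMod.intCast_zmod_eq_zero_iff_dvd _ _).1 hρ0).mul_left _)
  rw [mul_comm, mul_nsmul'] at hc'
  exact hB' ((M₁.dvd_iff hp (hc₁.isSmoothAt_of_dvd hp hB₁) hj hc').2 (hB₁.mul_right _))

theorem dvd_of_forall_dvd_mul {v : Fin 3 → ℤ} (hv : ∀ d : ℤ, (∀ i, d ∣ v i) → IsUnit d) {a b : ℤ}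
    (h : ∀ i, a ∣ b * v i) : a ∣ b := by
  have hu : IsUnit (gcd (v 0) (gcd (v 1) (v 2))) := hv _ fun i => by
    fin_cases i
    · exact gcd_dvd_left _ _
    · exact (gcd_dvd_right _ _).trans (gcd_dvd_left _ _)
    · exact (gcd_dvd_right _ _).trans (gcd_dvd_right _ _)
  have h1 : a ∣ b * gcd (v 1) (v 2) :=
    (dvd_gcd (h 1) (h 2)).trans (gcd_mul_left' b (v 1) (v 2)).dvd
  have h2 : a ∣ b * gcd (v 0) (gcd (v 1) (v 2)) :=
    (dvd_gcd (h 0) h1).trans (gcd_mul_left' b (v 0) _).dvd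
  exact hu.dvd_mul_right.1 h2

theorem IsIntCoords.isPrimitiveCoords (hc : IsIntCoords P A B C) :
    IsPrimitiveCoords P ![A * B, C, B ^ 3] := by
  refine ⟨fun d hd => ?_, (B : ℚ) ^ 3, pow_ne_zero 3 (by exact_mod_cast hc.pos.ne'), fun i => ?_⟩
  · by_contra hu
    obtain ⟨q, hq, hqd⟩ := Int.exists_prime_and_dvd (n := d) fun h => hu (Int.isUnit_iff_natAbs_eq.2 h)
    have hB : q ∣ B := hq.dvd_of_dvd_pow (hqd.trans (hd 2))
    have hC : q ∣ C := hqd.trans (hd 1)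
    have hA : q ∣ A ^ 3 := by
      have : A ^ 3 = C * (C + W.a₁ * A * B + W.a₃ * B ^ 3) -
          B * (W.a₂ * A ^ 2 * B + W.a₄ * A * B ^ 3 + W.a₆ * B ^ 5) := by
        linear_combination -hc.eqn
      rw [this]
      exact dvd_sub (hC.mul_right _) (hB.mul_right _)
    exact hq.not_isUnit (hc.isCoprime.isUnit_of_dvd' (hq.dvd_of_dvd_pow hA) hB)
  · have hx := hc.x_mul
    have hy := hc.y_mul
    rcases P with _ | ⟨x, y, h⟩
    · exact absurd rfl hc.ne_zero
    simp only [xCoord, yCoord] at hx hy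
    fin_cases i
    · simp [homCoords, ← hx]
      ring
    · simp [homCoords, ← hy]
      ring
    · simp [homCoords]

theorem IsPrimitiveCoords.eq_or_eq_neg {u v : Fin 3 → ℤ} (hu : IsPrimitiveCoords P u)
    (hv : IsPrimitiveCoords P v) : u = v ∨ u = -v := by
  obtain ⟨hu, c, hc0, hc⟩ := hu
  obtain ⟨hv, d, hd0, hd⟩ := hv
  have key : ∀ i, (c / d).num * v i = (c / d).den * u i := fun i => by
    have : ((c / d).num : ℚ) * v i = (c / d).den * u i := by
      rw [← Rat.mul_den_eq_num, hc, hd]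
      field_simp
    exact_mod_cast this
  have h1 := dvd_of_forall_dvd_mul hv fun i => (key i).symm ▸ dvd_mul_right _ (u i)
  have h2 := dvd_of_forall_dvd_mul hu fun i => (key i) ▸ dvd_mul_right _ (v i)
  have hden : ((c / d).den : ℤ) ≠ 0 := by exact_mod_cast (c / d).den_nz
  rcases Int.natAbs_eq_natAbs_iff.1 (Int.natAbs_eq_of_dvd_dvd h1 h2) with h | h
  · left
    funext i
    have := key i
    rw [← h] at this
    exact (mul_left_cancel₀ hden this).symm
  · right
    funext i
    have := key i
    rw [show (c / d).num = -((c / d).den : ℤ) by rw [h, neg_neg]] at this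
    refine mul_left_cancel₀ hden ?_
    rw [← this, Pi.neg_apply]
    ring

theorem nonsingular_intCoords_iff (hc : IsIntCoords P A B C) (hp : p.Prime) :
    (W.map (Int.castRingHom (ZMod p))).toProjective.Nonsingular
      (fun i => ((![A * B, C, B ^ 3] i : ℤ) : ZMod p)) ↔ IsSmoothAt W p A B C := by
  have := Fact.mk hp
  have heq := congrArg (Int.cast : ℤ → ZMod p) hc.eqn
  push_cast at heq
  have hE : (W.map (Int.castRingHom (ZMod p))).toProjective.Equation
      (fun i => ((![A * B, C, B ^ 3] i : ℤ) : ZMod p)) := by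
    rw [Projective.equation_iff]
    simp
    linear_combination (B : ZMod p) ^ 3 * heq
  by_cases hB : (p : ℤ) ∣ B
  · have hB0 := (ZMod.intCast_zmod_eq_zero_iff_dvd B p).2 hB
    have hA0 := mt (ZMod.intCast_zmod_eq_zero_iff_dvd A p).1 (hc.not_dvd_left hp hB)
    -- The reduction is (0 : C : 0), where the Z-partial is C², nonzero because C² ≡ A³.
    refine iff_of_true ⟨hE, Or.inr (Or.inr ?_)⟩ (hc.isSmoothAt_of_dvd hp hB)
    rw [Projective.eval_polynomialZ]
    simp [hB0]
    intro h
    rw [hB0, h] at heq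
    exact hA0 (pow_eq_zero_iff (n := 3) (by norm_num) |>.1 (by linear_combination -heq))
  · have hB0 := mt (ZMod.intCast_zmod_eq_zero_iff_dvd B p).1 hB
    rw [Projective.nonsingular_iff_of_Z_ne_zero (by simpa using hB0), and_iff_right hE,
      Projective.eval_polynomialX, Projective.eval_polynomialY, IsSmoothAt, not_and_or,
      ← ZMod.intCast_zmod_eq_zero_iff_dvd, ← ZMod.intCast_zmod_eq_zero_iff_dvd]
    refine or_congr (not_congr ?_) (not_congr ?_)
    · rw [← mul_eq_zero_iff_left (b := ((partialX W A B C : ℤ) : ZMod p)) (pow_ne_zero 2 hB0)]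
      refine iff_of_eq (congrArg (· = 0) ?_)
      simp [partialX]
      ring
    · rw [← mul_eq_zero_iff_left (b := ((partialY W A B C : ℤ) : ZMod p)) (pow_ne_zero 3 hB0)]
      refine iff_of_eq (congrArg (· = 0) ?_)
      simp [partialY]
      ring

theorem isNonsingularMod_iff (hc : IsIntCoords P A B C) (hp : p.Prime) :
    IsNonsingularMod p P ↔ IsSmoothAt W p A B C := by
  rw [← nonsingular_intCoords_iff hc hp]
  refine ⟨fun ⟨v, hv, hns⟩ => ?_, fun h => ⟨_, hc.isPrimitiveCoords, h⟩⟩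
  rcases hv.eq_or_eq_neg hc.isPrimitiveCoords with rfl | rfl
  · exact hns
  · rw [← Projective.nonsingular_smul _ (u := -1) isUnit_one.neg]
    convert! hns using 1
    funext i
    simp

theorem isRatWardEDS_beta (hP : ¬ IsOfFinAddOrder P)
    (h : ∀ p : ℕ, p.Prime → IsNonsingularMod p P) : IsRatWardEDS (beta P) := by
  obtain ⟨A, B, C, hc⟩ := exists_isIntCoords (P := P) fun h0 => hP (h0 ▸ IsOfFinAddOrder.zero)
  exact isRatWardEDS_beta_of_isSmoothAt hP hc fun p hp => (isNonsingularMod_iff hc hp).1 (h p hp)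

theorem IsNonsingularMod.nsmul (hP : ¬ IsOfFinAddOrder P) (hp : p.Prime)
    (h : IsNonsingularMod p P) {k : ℕ} (hk : 1 ≤ k) : IsNonsingularMod p (k • P) := by
  obtain ⟨A, B, C, hc⟩ := exists_isIntCoords (P := P) fun h0 => hP (h0 ▸ IsOfFinAddOrder.zero)
  obtain ⟨A', B', C', hc'⟩ := exists_isIntCoords (nsmul_ne_zero_of_not_isOfFinAddOrder hP hk)
  rw [isNonsingularMod_iff hc hp] at h
  rw [isNonsingularMod_iff hc' hp]
  exact h.nsmul hP hc hp hk hc'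

end NonsingularReduction

/-! ### Finiteness of the orders r(p, P) and of M(P). -/

section FiniteIndex

variable {W : WeierstrassCurve ℤ} {P : RatPoint W} {A B C : ℤ} {p : ℕ}

/-- Δ lies in the ideal generated by the equation and its partials, so N need not be prime; B is
inverted modulo N to return to affine coordinates. -/
theorem not_dvd_partial_of_not_dvd_Δ (hc : IsIntCoords P A B C) {N : ℕ} (hB : IsCoprime B N)
    (hΔ : ¬ (N : ℤ) ∣ W.Δ) :
    ¬ ((N : ℤ) ∣ partialX W A B C ∧ (N : ℤ) ∣ partialY W A B C) := by
  rintro ⟨hX, hY⟩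
  rw [← ZMod.intCast_zmod_eq_zero_iff_dvd] at hX hY hΔ
  obtain ⟨u, v, huv⟩ := hB
  have hu := congrArg (Int.cast : ℤ → ZMod N) huv
  have heq := congrArg (Int.cast : ℤ → ZMod N) hc.eqn
  simp only [partialX, partialY] at hX hY
  push_cast at hu heq hX hY
  rw [ZMod.natCast_self, mul_zero, add_zero] at hu
  set f := Int.castRingHom (ZMod N)
  have h1 : ∀ k, (u : ZMod N) ^ k * (B : ZMod N) ^ k = 1 := fun k => by
    rw [← mul_pow, hu, one_pow]
  have he : (W.map f).toAffine.Equation ((A : ZMod N) * u ^ 2) ((C : ZMod N) * u ^ 3) := by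
    rw [Affine.equation_iff]
    simp [f]
    linear_combination (u : ZMod N) ^ 6 * heq - (W.a₁ * A * C : ZMod N) * u ^ 5 * hu
      - (W.a₃ * C : ZMod N) * u ^ 3 * h1 3 + (W.a₂ * A ^ 2 : ZMod N) * u ^ 4 * h1 2
      + (W.a₄ * A : ZMod N) * u ^ 2 * h1 4 + (W.a₆ : ZMod N) * h1 6
  have hn := ((W.map f).toAffine.equation_iff_nonsingular_of_Δ_ne_zero
    (by rwa [WeierstrassCurve.map_Δ])).1 he
  rw [Affine.nonsingular_iff'] at hn
  simp [f] at hn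
  rcases hn.2 with h | h
  · exact h (by
      linear_combination (u : ZMod N) ^ 4 * hX - (W.a₁ * C : ZMod N) * u ^ 3 * hu
        + (2 * W.a₂ * A : ZMod N) * u ^ 2 * h1 2 + (W.a₄ : ZMod N) * h1 4)
  · exact h (by
      linear_combination (u : ZMod N) ^ 3 * hY - (W.a₁ * A : ZMod N) * u ^ 2 * hu
        - (W.a₃ : ZMod N) * h1 3)

/-- l is the slope of the line through P and -Q. When P ≡ Q the right-hand sides of the first two
identities become, up to sign, the partials at Q. -/
theorem exists_slope {P Q : RatPoint W} (hP : P ≠ 0) (hQ : Q ≠ 0) (h : xCoord P ≠ xCoord Q) :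
    ∃ l : ℚ, l * (xCoord P - xCoord Q) = yCoord P + yCoord Q + W.a₁ * xCoord Q + W.a₃ ∧
      l * (yCoord P - yCoord Q) = xCoord P ^ 2 + xCoord P * xCoord Q + xCoord Q ^ 2 +
        W.a₂ * (xCoord P + xCoord Q) + W.a₄ - W.a₁ * yCoord P ∧
      xCoord (P - Q) = l ^ 2 + W.a₁ * l - W.a₂ - xCoord P - xCoord Q := by
  rcases P with _ | ⟨x₁, y₁, h₁⟩
  · exact absurd rfl hP
  rcases Q with _ | ⟨x₂, y₂, h₂⟩
  · exact absurd rfl hQ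
  change x₁ ≠ x₂ at h
  have e₁ := (Affine.equation_iff x₁ y₁).1 h₁.1
  have e₂ := (Affine.equation_iff x₂ y₂).1 h₂.1
  have hd : x₁ - x₂ ≠ 0 := sub_ne_zero.2 h
  simp only [WeierstrassCurve.baseChange, map_a₁, map_a₂, map_a₃, map_a₄, map_a₆,
    algebraMap_int_eq, eq_intCast] at e₁ e₂
  refine ⟨(y₁ + y₂ + W.a₁ * x₂ + W.a₃) / (x₁ - x₂), ?_, ?_, ?_⟩
  · exact div_mul_cancel₀ _ hd
  · simp only [xCoord, yCoord]
    field_simp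
    linear_combination e₁ - e₂
  · rw [sub_eq_add_neg (Affine.Point.some x₁ y₁ h₁), Affine.Point.neg_some,
      Affine.Point.add_of_X_ne h]
    simp only [xCoord, Affine.slope_of_X_ne h, Affine.addX, Affine.negY,
      WeierstrassCurve.baseChange, map_a₁, map_a₂, map_a₃, algebraMap_int_eq, eq_intCast]
    ring

/-- The slope is a root of a monic quadratic involving x(P - Q), so its denominator is prime to N.
As P ≡ Q modulo N, the left sides of the slope identities vanish modulo N, hence so do the partials.
-/
theorem dvd_partial_of_congr {P Q : RatPoint W} {A₁ B₁ C₁ A₂ B₂ C₂ A₃ B₃ C₃ : ℤ} {N : ℕ}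
    (h₁ : IsIntCoords P A₁ B₁ C₁) (h₂ : IsIntCoords Q A₂ B₂ C₂) (h₃ : IsIntCoords (P - Q) A₃ B₃ C₃)
    (h : xCoord P ≠ xCoord Q) (hB₂ : IsCoprime B₂ N) (hB₃ : IsCoprime B₃ N)
    (hA : (A₁ : ZMod N) = A₂) (hB : (B₁ : ZMod N) = B₂) (hC : (C₁ : ZMod N) = C₂) :
    (N : ℤ) ∣ partialX W A₂ B₂ C₂ ∧ (N : ℤ) ∣ partialY W A₂ B₂ C₂ := by
  obtain ⟨l, hl₁, hl₂, hl₃⟩ := exists_slope h₁.ne_zero h₂.ne_zero h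
  have hx₁ := h₁.x_mul
  have hx₂ := h₂.x_mul
  have hx₃ := h₃.x_mul
  have hy₁ := h₁.y_mul
  have hy₂ := h₂.y_mul
  obtain ⟨z, hz⟩ := exists_int_of_sq_add_mul (q := ((B₁ * B₂ * B₃) ^ 2 : ℚ) * l)
    (m := W.a₁ * (B₁ * B₂ * B₃) ^ 2)
    (r := A₃ * B₁ ^ 4 * B₂ ^ 4 * B₃ ^ 2 + A₁ * B₁ ^ 2 * B₂ ^ 4 * B₃ ^ 4 +
      A₂ * B₁ ^ 4 * B₂ ^ 2 * B₃ ^ 4 + W.a₂ * (B₁ * B₂ * B₃) ^ 4) (by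
    push_cast
    rw [← hx₁, ← hx₂, ← hx₃]
    linear_combination (-(B₁ * B₂ * B₃) ^ 4 : ℚ) * hl₃)
  have i₁ : z * (B₁ * B₂) * (A₁ * B₂ ^ 2 - A₂ * B₁ ^ 2) = (B₁ * B₂ * B₃) ^ 2 *
      (C₁ * B₂ ^ 3 + C₂ * B₁ ^ 3 + W.a₁ * A₂ * B₂ * B₁ ^ 3 + W.a₃ * B₁ ^ 3 * B₂ ^ 3) := by
    have : (z : ℚ) * (B₁ * B₂) * (A₁ * B₂ ^ 2 - A₂ * B₁ ^ 2) = (B₁ * B₂ * B₃) ^ 2 *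
      (C₁ * B₂ ^ 3 + C₂ * B₁ ^ 3 + W.a₁ * A₂ * B₂ * B₁ ^ 3 + W.a₃ * B₁ ^ 3 * B₂ ^ 3) := by
      rw [hz, ← hx₁, ← hx₂, ← hy₁, ← hy₂]
      linear_combination ((B₁ * B₂ * B₃) ^ 2 * B₁ ^ 3 * B₂ ^ 3 : ℚ) * hl₁
    exact_mod_cast this
  have i₂ : z * (B₁ * B₂) * (C₁ * B₂ ^ 3 - C₂ * B₁ ^ 3) = (B₁ * B₂ * B₃) ^ 2 *
      (A₁ ^ 2 * B₂ ^ 4 + A₁ * A₂ * B₁ ^ 2 * B₂ ^ 2 + A₂ ^ 2 * B₁ ^ 4 +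
        W.a₂ * (A₁ * B₁ ^ 2 * B₂ ^ 4 + A₂ * B₁ ^ 4 * B₂ ^ 2) + W.a₄ * B₁ ^ 4 * B₂ ^ 4 -
        W.a₁ * C₁ * B₁ * B₂ ^ 4) := by
    have : (z : ℚ) * (B₁ * B₂) * (C₁ * B₂ ^ 3 - C₂ * B₁ ^ 3) = (B₁ * B₂ * B₃) ^ 2 *
      (A₁ ^ 2 * B₂ ^ 4 + A₁ * A₂ * B₁ ^ 2 * B₂ ^ 2 + A₂ ^ 2 * B₁ ^ 4 +
        W.a₂ * (A₁ * B₁ ^ 2 * B₂ ^ 4 + A₂ * B₁ ^ 4 * B₂ ^ 2) + W.a₄ * B₁ ^ 4 * B₂ ^ 4 -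
        W.a₁ * C₁ * B₁ * B₂ ^ 4) := by
      rw [hz, ← hx₁, ← hx₂, ← hy₁, ← hy₂]
      linear_combination ((B₁ * B₂ * B₃) ^ 2 * B₁ ^ 4 * B₂ ^ 4 : ℚ) * hl₂
    exact_mod_cast this
  have j₁ := congrArg (Int.cast : ℤ → ZMod N) i₁
  have j₂ := congrArg (Int.cast : ℤ → ZMod N) i₂
  push_cast at j₁ j₂
  rw [hA, hB, hC] at j₁ j₂
  have hco : ∀ k, IsCoprime (N : ℤ) ((B₂ * B₂ * B₃) ^ 2 * B₂ ^ k) := fun k =>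
    (((hB₂.mul_left hB₂).mul_left hB₃).pow_left.mul_left hB₂.pow_left).symm
  constructor
  · refine (hco 4).dvd_of_dvd_mul_left ?_
    rw [← ZMod.intCast_zmod_eq_zero_iff_dvd, partialX]
    push_cast
    linear_combination j₂
  · refine (hco 3).dvd_of_dvd_mul_left ?_
    rw [← ZMod.intCast_zmod_eq_zero_iff_dvd, partialY]
    push_cast
    linear_combination -j₁

/-- If every multiple were singular modulo p, every B would be prime to p. Two multiples agree
modulo N by pigeonhole, and their difference is again such a multiple, so both partials vanish
modulo N, although N does not divide Δ. -/
theorem exists_isNonsingularMod_nsmul (hΔ : W.Δ ≠ 0) (hP : ¬ IsOfFinAddOrder P) (hp : p.Prime) :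
    ∃ n : ℕ, 0 < n ∧ IsNonsingularMod p (n • P) := by
  by_contra! hns
  have hcoord : ∀ n : ℕ, ∃ v : ℤ × ℤ × ℤ, IsIntCoords ((n + 1) • P) v.1 v.2.1 v.2.2 := fun n => by
    obtain ⟨A, B, C, hc⟩ := exists_isIntCoords
      (nsmul_ne_zero_of_not_isOfFinAddOrder hP (Nat.le_add_left 1 n))
    exact ⟨(A, B, C), hc⟩
  choose v hv using hcoord
  -- This exponent is a crude choice ensuring N > |Δ|.
  set N := p ^ W.Δ.natAbs with hN
  have hNΔ : ¬ (N : ℤ) ∣ W.Δ := fun h => by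
    have := Nat.le_of_dvd (Int.natAbs_pos.2 hΔ) (Int.natCast_dvd.1 h)
    exact absurd this (not_le.2 (Nat.lt_pow_self hp.one_lt))
  have : NeZero N := ⟨pow_ne_zero _ hp.ne_zero⟩
  have hcop : ∀ n, IsCoprime (v n).2.1 (N : ℤ) := fun n => by
    rw [hN, Nat.cast_pow]
    refine IsCoprime.pow_right (IsCoprime.symm ?_)
    refine ((Nat.prime_iff_prime_int.1 hp).coprime_iff_not_dvd).2 fun h => ?_
    exact hns (n + 1) (Nat.succ_pos n)
      ((isNonsingularMod_iff (hv n) hp).2 ((hv n).isSmoothAt_of_dvd hp h))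
  obtain ⟨i, j, hij, he⟩ := Finite.exists_ne_map_eq_of_infinite
    fun n => (((v n).1 : ZMod N), ((v n).2.1 : ZMod N), ((v n).2.2 : ZMod N))
  wlog hlt : j < i generalizing i j
  · exact this j i hij.symm he.symm (lt_of_le_of_ne (not_lt.1 hlt) hij)
  simp only [Prod.mk.injEq] at he
  -- `v n` belongs to (n + 1)P, so (i - j)P has index i - j - 1.
  have hsub : (i - j - 1 + 1) • P = (i + 1) • P - (j + 1) • P := by
    rw [show i - j - 1 + 1 = (i + 1) - (j + 1) by omega, sub_nsmul _ (by omega), sub_eq_add_neg]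
  have h₃ := hv (i - j - 1)
  rw [hsub] at h₃
  refine not_dvd_partial_of_not_dvd_Δ (hv j) (hcop j) hNΔ
    (dvd_partial_of_congr (hv i) (hv j) h₃ ?_ (hcop j) (hcop _) he.1 he.2.1 he.2.2)
  exact ((isAbscissaSeq_nsmul hP).ne (i + 1) (j + 1) (by omega) (by omega)).symm

theorem isNonsingularMod_of_not_dvd_Δ (hP : P ≠ 0) (hp : p.Prime) (hΔ : ¬ (p : ℤ) ∣ W.Δ) :
    IsNonsingularMod p P := by
  obtain ⟨A, B, C, hc⟩ := exists_isIntCoords hP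
  rw [isNonsingularMod_iff hc hp]
  by_cases hB : (p : ℤ) ∣ B
  · exact hc.isSmoothAt_of_dvd hp hB
  · exact not_dvd_partial_of_not_dvd_Δ hc
      (((Nat.prime_iff_prime_int.1 hp).coprime_iff_not_dvd).2 hB).symm hΔ

theorem redOrder_spec (hΔ : W.Δ ≠ 0) (hP : ¬ IsOfFinAddOrder P) (hp : p.Prime) :
    0 < redOrder p P ∧ IsNonsingularMod p (redOrder p P • P) :=
  Nat.sInf_mem (s := {n : ℕ | 0 < n ∧ IsNonsingularMod p (n • P)})
    (exists_isNonsingularMod_nsmul hΔ hP hp)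

theorem redOrder_eq_one (hP : P ≠ 0) (hp : p.Prime) (hΔ : ¬ (p : ℤ) ∣ W.Δ) :
    redOrder p P = 1 := by
  have h1 : 1 ∈ {n : ℕ | 0 < n ∧ IsNonsingularMod p (n • P)} :=
    ⟨one_pos, by rw [one_nsmul]; exact isNonsingularMod_of_not_dvd_Δ hP hp hΔ⟩
  exact le_antisymm (Nat.sInf_le h1) (Nat.sInf_mem ⟨1, h1⟩).1

theorem lcmRedOrder_spec (hΔ : W.Δ ≠ 0) (hP : ¬ IsOfFinAddOrder P) :
    0 < lcmRedOrder P ∧ ∀ p : ℕ, p.Prime → redOrder p P ∣ lcmRedOrder P := by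
  refine Nat.sInf_mem (s := {m : ℕ | 0 < m ∧ ∀ p : ℕ, p.Prime → redOrder p P ∣ m})
    -- Only primes dividing Δ contribute, so this finite product is a common multiple.
    ⟨∏ p ∈ W.Δ.natAbs.primeFactors, redOrder p P, Finset.prod_pos fun p hp =>
      (redOrder_spec hΔ hP (Nat.prime_of_mem_primeFactors hp)).1, fun p hp => ?_⟩
  by_cases hd : (p : ℤ) ∣ W.Δ
  · exact Finset.dvd_prod_of_mem _ (Nat.mem_primeFactors.2
      ⟨hp, Int.natCast_dvd.1 hd, Int.natAbs_ne_zero.2 hΔ⟩)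
  · rw [redOrder_eq_one (fun h0 => hP (by rw [h0]; exact IsOfFinAddOrder.zero)) hp hd]
    exact one_dvd _

theorem isNonsingularMod_lcmRedOrder_nsmul (hΔ : W.Δ ≠ 0) (hP : ¬ IsOfFinAddOrder P)
    (hp : p.Prime) : IsNonsingularMod p (lcmRedOrder P • P) := by
  obtain ⟨hpos, hdvd⟩ := lcmRedOrder_spec hΔ hP
  obtain ⟨hr, hns⟩ := redOrder_spec hΔ hP hp
  obtain ⟨k, hk⟩ := hdvd p hp
  have hk1 : 1 ≤ k := Nat.pos_of_ne_zero fun h0 => by simp [hk, h0] at hpos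
  rw [hk, mul_comm, mul_nsmul']
  exact hns.nsmul (not_isOfFinAddOrder_nsmul hP hr) hp hk1

end FiniteIndex

end EDS

theorem mainTheorem4 (W : WeierstrassCurve ℤ) (hE : (W.baseChange ℚ).IsElliptic) :
    (∀ P : EDS.RatPoint W, ¬ IsOfFinAddOrder P →
      (∀ p : ℕ, p.Prime → EDS.IsNonsingularMod p P) →
        EDS.IsRatWardEDS (EDS.beta P)) ∧
    (∀ P : EDS.RatPoint W, ¬ IsOfFinAddOrder P →
      0 < EDS.lcmRedOrder P ∧ EDS.IsRatWardEDS (EDS.beta (EDS.lcmRedOrder P • P))) := by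
  have hΔ : W.Δ ≠ 0 := fun h0 => hE.isUnit.ne_zero (by
    rw [WeierstrassCurve.baseChange, WeierstrassCurve.map_Δ, h0, map_zero])
  refine ⟨fun P hP h => EDS.isRatWardEDS_beta hP h, fun P hP => ?_⟩
  have hpos := (EDS.lcmRedOrder_spec hΔ hP).1
  exact ⟨hpos, EDS.isRatWardEDS_beta (EDS.not_isOfFinAddOrder_nsmul hP hpos) fun p hp =>
    EDS.isNonsingularMod_lcmRedOrder_nsmul hΔ hP hp⟩
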